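/- Let $(X,\Phi,Y,\Phi^\vee)$ be a reduced root datum with $\Phi$ finite ($X$, $Y$ free abelian groups of finite rank), with a chosen base of simple roots and corresponding positive roots $\Phi^+$. Let $W$ be its Weyl group, with simple reflections $s_\alpha$ ($\alpha$ simple), length function $l$, Bruhat order $\leqslant$ and long element $w_0$. Put $\varepsilon_w=(-1)^{l(w)}$ and $q_w=q^{l(w)}$, where $q$ is an indeterminate, and let $f\mapsto\overline f$ be the automorphism of the field $\mathbb C(q)$ that fixes $\mathbb C$ and sends $q$ to $q^{-1}$. Let $\mathcal H$ be the Iwahori Hecke algebra of $W$ over $\mathbb C(q)$, with basis $(T_w)_{w\in W}$, where $T_wT_{w'}=T_{ww'}$ if $l(ww')=l(w)+l(w')$ and $T_s^2=(q-1)T_s+q$ for each simple reflection $s$. Let $\Lambda:\mathcal H\to\mathbb C(q)$ be the linear functional with $\Lambda(T_1)=1$ and $\Lambda(T_w)=0$ for $w\neq 1$, and put $\psi_u=\sum_{x\geqslant u}T_x$. Let $\mathbf z\in\operatorname{Hom}(X,\mathbb C^\times)$ be a point of the complex torus with character group $X$, write $\mathbf z^\lambda\in\mathbb C^\times$ for its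 value at $\lambda\in X$, let $W$ act by $(w\mathbf z)^\lambda=\mathbf z^{w^{-1}\lambda}$, and assume that $\mathbf z$ is regular, that is, $\mathbf z^\alpha\neq1$ for all $\alpha\in\Phi$. For a simple reflection $s=s_\alpha$ put \[ \mu_{\mathbf z}(s)=q^{-1}T_s+(1-q^{-1})\frac{\mathbf z^\alpha}{1-\mathbf z^\alpha}, \] and extend this to $\mu_{\mathbf z}(w)\in\mathcal H$ for $w\in W$ by $\mu_{\mathbf z}(1)=1$ and $\mu_{\mathbf z}(w_1w_2)=\mu_{\mathbf z}(w_2)\,\mu_{w_2\mathbf z}(w_1)$ whenever $l(w_1w_2)=l(w_1)+l(w_2)$ (thus $\mu_{\mathbf z}(w)$ is a product of factors $\mu(s)$ along a reduced word of $w$). For $u,v\in W$ define $m_{u,v}=m_{u,v}(\mathbf z)\in\mathbb C(q)$ and the deformed $R$-polynomials $r_{u,v}=r_{u,v}(\mathbf z)\in\mathbb C(q)$ by \[ m_{u,v}=\Lambda\bigl(\psi_u\,\mu_{\mathbf z}(v)\bigr),\qquad \mu_{\mathbf z}(v)=\sum_{u\in W}q_u^{-1}\,\overline{r_{u,v}}\;T_{u^{-1}}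 . \] **Theorem** (Nakasuji--Naruse). Let $u,v\in W$ with $u\leqslant v$. Then \[ \sum_{u\leqslant x\leqslant v} r_{u,x}\,\varepsilon_x\varepsilon_v\, r_{w_0v,w_0x}=\delta_{u,v} \qquad\text{and}\qquad \sum_{u\leqslant x\leqslant v} m_{u,x}\,\varepsilon_x\varepsilon_v\, m_{w_0v,w_0x}=\delta_{u,v}. \] Moreover, the matrices $(m_{u,v})_{u,v\in W}$ and $(r_{u,v})_{u,v\in W}$ are invertible, and their inverse matrices $(m'_{u,v})$ and $(r'_{u,v})$ are given, for all $u,v\in W$, by \[ m'_{u,v}=\varepsilon_u\varepsilon_v\,m_{w_0v,w_0u},\qquad r'_{u,v}=\varepsilon_u\varepsilon_v\,r_{w_0v,w_0u}. \] -/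

import Mathlib

noncomputable section

namespace CasselmanBasis

open RootPairing

variable {ι X Y : Type*} [Finite ι] [AddCommGroup X] [AddCommGroup Y] {P : RootDatum ι X Y}

/-! ### The Weyl group as a Coxeter group: words, length, Bruhat order, long element -/

/-- The Weyl group of a (finite) root datum is finite. -/
instance finite_weylGroup : Finite P.weylGroup := by
  cases nonempty_fintype ι
  refine Finite.of_injective (fun w : P.weylGroup => Equiv.indexHom P w.1) ?_
  have key : ∀ w : P.weylGroup, Equiv.indexHom P w.1 = 1 → w = 1 := by
    intro w hw
    have hspan : ∀ x : X, w • x - x ∈ P.rootSpan ℤ := by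
      obtain ⟨g, hg⟩ := w
      clear hw
      induction hg using weylGroup.induction with
      | mem i =>
        intro x
        change P.reflection i x - x ∈ _
        rw [reflection_apply]
        have : x - P.coroot' i x • P.root i - x = -(P.coroot' i x • P.root i) := by abel
        rw [this]
        exact neg_mem (Submodule.smul_mem _ _ (Submodule.subset_span ⟨i, rfl⟩))
      | one =>
        intro x
        change (1 : P.weylGroup) • x - x ∈ _
        simp
      | mul g h hg hh ihg ihh =>
        intro x
        have h1 := ihg ((⟨h, hh⟩ : P.weylGroup) • x)
        have h2 := ihh x
        have := add_mem h1 h2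
        rw [sub_add_sub_cancel] at this
        exact this
    have hfix : ∀ i, w • P.root i = P.root i := by
      intro i
      rw [weylGroup_apply_root]
      have : P.weylGroupToPerm w = 1 := hw
      rw [this]; rfl
    have hker : ∀ x : X, w • x - x ∈ LinearMap.ker P.RootForm := by
      intro x
      set d := w • x - x with hd
      have hroot : ∀ j, P.RootForm d (P.root j) = 0 := by
        intro j
        have := InvariantForm.apply_weylGroup_smul P (B := P.toInvariantForm) w x (P.root j)
        rw [hfix j] at this
        rw [hd, map_sub, LinearMap.sub_apply, sub_eq_zero]
        exact this
      have hdd : P.RootForm d d = 0 := by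
        have : P.rootSpan ℤ ≤ LinearMap.ker (P.RootForm d) :=
          Submodule.span_le.mpr (by rintro _ ⟨j, rfl⟩; exact hroot j)
        exact this (hspan x)
      rw [rootForm_apply_apply,
        Finset.sum_eq_zero_iff_of_nonneg (fun i _ => mul_self_nonneg _)] at hdd
      rw [LinearMap.mem_ker]
      ext y
      rw [rootForm_apply_apply]
      exact Finset.sum_eq_zero fun i hi => by
        rw [mul_self_eq_zero.mp (hdd i hi), zero_mul]
    have h1 : ∀ x : X, w • x = x := fun x => by
      have := (Submodule.disjoint_def.mp P.disjoint_rootSpan_ker_rootForm) _ (hspan x) (hker x)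
      exact sub_eq_zero.mp this
    apply Subtype.ext
    apply Equiv.weightHom_injective P
    ext x
    exact h1 x
  intro w w' h
  have h' : Equiv.indexHom P w.1 = Equiv.indexHom P w'.1 := h
  have := key (w * w'⁻¹) (by
    change Equiv.indexHom P (w.1 * w'.1⁻¹) = 1
    rw [map_mul, map_inv, h', mul_inv_cancel])
  exact mul_inv_eq_one.mp this

instance fintype_weylGroup : Fintype P.weylGroup := Fintype.ofFinite _

instance decidableEq_weylGroup : DecidableEq P.weylGroup := Classical.decEq _

/-- The simple reflection `s_α` attached to the simple root `α` with index `i`. -/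
def simpleRefl (b : P.Base) (i : b.support) : P.weylGroup := weylGroup.ofIdx P i

/-- The product `s₁ s₂ ⋯ sₖ` in the Weyl group of a word in the simple reflections. -/
def wordProd (b : P.Base) (l : List b.support) : P.weylGroup := (l.map (simpleRefl b)).prod

theorem exists_word [P.IsReduced] (b : P.Base) (w : P.weylGroup) : ∃ l, wordProd b l = w := by
  have hmul : ∀ x y : P.weylGroup, (∃ l, wordProd b l = x) → (∃ l, wordProd b l = y) →
      ∃ l, wordProd b l = x * y := by
    rintro _ _ ⟨l, rfl⟩ ⟨l', rfl⟩
    exact ⟨l ++ l', by simp [wordProd]⟩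
  have hrefl : ∀ i, ∃ l, wordProd b l = weylGroup.ofIdx P i := by
    intro i
    have hconj : ∀ i j, weylGroup.ofIdx P (P.reflectionPerm j i) =
        weylGroup.ofIdx P j * weylGroup.ofIdx P i * weylGroup.ofIdx P j := by
      intro i j
      apply Subtype.ext
      apply Equiv.weightHom_injective P
      ext x
      change P.reflection (P.reflectionPerm j i) x =
        P.reflection j (P.reflection i (P.reflection j x))
      rw [reflection_reflectionPerm]
      rfl
    refine b.induction_reflect (p := fun i => ∃ l, wordProd b l = weylGroup.ofIdx P i) i ?_ ?_ ?_
    · intro i hi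
      rw [hconj]
      exact hmul _ _ (hmul _ _ hi hi) hi
    · intro i hi
      exact ⟨[⟨i, hi⟩], by simp [wordProd, simpleRefl]⟩
    · intro i j hi hj
      have hj' : ∃ l, wordProd b l = weylGroup.ofIdx P j :=
        ⟨[⟨j, hj⟩], by simp [wordProd, simpleRefl]⟩
      rw [hconj]
      exact hmul _ _ (hmul _ _ hj' hi) hj'
  obtain ⟨g, hg⟩ := w
  induction hg using weylGroup.induction with
  | mem i => exact hrefl i
  | one => exact ⟨[], rfl⟩
  | mul g h hg hh ihg ihh => exact hmul _ _ ihg ihh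

/-- The length `l(w)`: the least number of simple reflections in a word representing `w`. -/
def length (b : P.Base) (w : P.weylGroup) : ℕ :=
  sInf {n | ∃ l : List b.support, wordProd b l = w ∧ l.length = n}

theorem exists_reducedWord [P.IsReduced] (b : P.Base) (w : P.weylGroup) :
    ∃ l : List b.support, wordProd b l = w ∧ l.length = length b w :=
  Nat.sInf_mem (s := {n | ∃ l : List b.support, wordProd b l = w ∧ l.length = n})
    ((exists_word b w).elim fun l hl => ⟨l.length, l, hl, rfl⟩)

/-- A reduced word for `w`. -/
def reducedWord [P.IsReduced] (b : P.Base) (w : P.weylGroup) : List b.support :=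
  (exists_reducedWord b w).choose

/-- The Bruhat order `u ≤ v`: the reflexive transitive closure of the relation
`x < x t` for `t` a reflection with `l(x) < l(x t)`. -/
def bruhatLE (b : P.Base) : P.weylGroup → P.weylGroup → Prop :=
  Relation.ReflTransGen fun x y =>
    ∃ i : ι, y = x * weylGroup.ofIdx P i ∧ length b x < length b y

open Classical in
/-- The Bruhat interval `[u, v] = {x | u ≤ x ≤ v}`. -/
def bruhatIcc (b : P.Base) (u v : P.weylGroup) : Finset P.weylGroup :=
  Finset.univ.filter fun x => bruhatLE b u x ∧ bruhatLE b x v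

open Classical in
/-- The upper set `{x | u ≤ x}` for the Bruhat order. -/
def bruhatIci (b : P.Base) (u : P.weylGroup) : Finset P.weylGroup :=
  Finset.univ.filter fun x => bruhatLE b u x

theorem exists_longest (b : P.Base) :
    ∃ w₀ : P.weylGroup, ∀ w, length b w ≤ length b w₀ :=
  Finite.exists_max (length b)

/-- The long element `w₀` of the Weyl group: the element of maximal length. -/
def longElement (b : P.Base) : P.weylGroup := (exists_longest b).choose

/-! ### Scalars: the field `ℂ(q)` and its involution `q ↦ q⁻¹` -/

/-- The field `ℂ(q)` of rational functions in the indeterminate `q`. -/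
abbrev Scalar : Type := RatFunc ℂ

/-- The indeterminate `q`. -/
abbrev q : Scalar := RatFunc.X

theorem aeval_inv_q_injective :
    Function.Injective (Polynomial.aeval (R := ℂ) (q⁻¹ : Scalar)) := by
  have h : Transcendental ℂ (q⁻¹ : Scalar) := by
    intro h
    exact RatFunc.transcendental_X (inv_inv (q : Scalar) ▸ h.inv)
  exact transcendental_iff_injective.mp h

/-- The involution `f ↦ f̄` of `ℂ(q)`: the field homomorphism that is the identity on `ℂ`
and sends `q` to `q⁻¹`. -/
def bar : Scalar →+* Scalar :=
  RatFunc.liftRingHom (Polynomial.aeval (R := ℂ) (q⁻¹ : Scalar)).toRingHom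
    (nonZeroDivisors_le_comap_nonZeroDivisors_of_injective _ aeval_inv_q_injective)

/-- The sign `ε_w = (-1)^{l(w)}`. -/
def eps (b : P.Base) (w : P.weylGroup) : Scalar := (-1) ^ length b w

/-- `q_w = q^{l(w)}`. -/
def qpow (b : P.Base) (w : P.weylGroup) : Scalar := q ^ length b w

/-! ### The Iwahori Hecke algebra

It is realized through its left regular representation on the free module with basis
`(T_w)_{w ∈ W}`; an element `h` of the algebra is recovered from the vector `h T_1`. -/

/-- The free `ℂ(q)`-module with basis `(T_w)`, `w ∈ W`; `T_w` is `Finsupp.single w 1`. -/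
abbrev HeckeModule (P : RootDatum ι X Y) : Type _ := P.weylGroup →₀ Scalar

/-- Left multiplication by `T_s`, `s` the simple reflection of index `i`:
`T_s T_w = T_{sw}` if `sw > w` and `T_s T_w = (q - 1) T_w + q T_{sw}` if `sw < w`. -/
def heckeGenMul (b : P.Base) (i : b.support) : Module.End Scalar (HeckeModule P) :=
  Finsupp.linearCombination Scalar fun w : P.weylGroup =>
    if length b w < length b (simpleRefl b i * w) then
      Finsupp.single (simpleRefl b i * w) (1 : Scalar)
    else Finsupp.single w (q - 1) + Finsupp.single (simpleRefl b i * w) q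

/-- The Iwahori Hecke algebra `𝓗` over `ℂ(q)`, generated by the `T_s`, `s` simple. -/
def heckeAlgebra (b : P.Base) : Subalgebra Scalar (Module.End Scalar (HeckeModule P)) :=
  Algebra.adjoin Scalar (Set.range (heckeGenMul b))

/-- The generator `T_s` of `𝓗`, `s` the simple reflection of index `i`. -/
def heckeGen (b : P.Base) (i : b.support) : heckeAlgebra b :=
  ⟨heckeGenMul b i, Algebra.subset_adjoin ⟨i, rfl⟩⟩

/-- The basis element `T_w = T_{s₁} ⋯ T_{sₖ}` of `𝓗`, `s₁ ⋯ sₖ` a reduced word for `w`. -/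
def heckeT [P.IsReduced] (b : P.Base) (w : P.weylGroup) : heckeAlgebra b :=
  ((reducedWord b w).map (heckeGen b)).prod

/-- The coefficient of `T_w` in `h ∈ 𝓗`. -/
def heckeCoeff (b : P.Base) (w : P.weylGroup) : heckeAlgebra b →ₗ[Scalar] Scalar where
  toFun h := (h : Module.End Scalar (HeckeModule P)) (Finsupp.single 1 1) w
  map_add' _ _ := rfl
  map_smul' _ _ := rfl

/-- The functional `Λ` on `𝓗` with `Λ(T_w) = 1` if `w = 1` and `Λ(T_w) = 0` otherwise. -/
def Lam (b : P.Base) : heckeAlgebra b →ₗ[Scalar] Scalar := heckeCoeff b 1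

/-- `ψ_u = ∑_{x ≥ u} T_x`. -/
def psi [P.IsReduced] (b : P.Base) (u : P.weylGroup) : heckeAlgebra b := ∑ x ∈ bruhatIci b u, heckeT b x

/-! ### The dual torus -/

/-- The complex points `Hom(X, ℂˣ)` of the torus with character lattice `X`. -/
abbrev Torus (X : Type*) [AddCommGroup X] : Type _ := Multiplicative X →* ℂˣ

/-- The value `z^λ` of the character `λ` at the point `z`. -/
def charVal (z : Torus X) (lam : X) : ℂ := (z (Multiplicative.ofAdd lam) : ℂ)

/-- The action of the Weyl group on the torus, `(w z)^λ = z^{w⁻¹ λ}`. -/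
def torusAct (w : P.weylGroup) (z : Torus X) : Torus X :=
  z.comp (AddMonoidHom.toMultiplicative (DistribSMul.toAddMonoidHom X w⁻¹))

/-- The regular set: `z^α ≠ 1` for all roots `α`. -/
def IsRegular (P : RootDatum ι X Y) (z : Torus X) : Prop := ∀ i, charVal z (P.root i) ≠ 1

/-! ### The elements `μ_z(w)` and the coefficients `m`, `r` -/

/-- `μ_z(s) = q⁻¹ T_s + (1 - q⁻¹) z^α / (1 - z^α)` for the simple reflection `s = s_α`. -/
def muSimple (b : P.Base) (z : Torus X) (i : b.support) : heckeAlgebra b :=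
  (q⁻¹ : Scalar) • heckeGen b i +
    algebraMap Scalar (heckeAlgebra b)
      ((1 - q⁻¹) *
        RatFunc.C (charVal z (P.root i) / (1 - charVal z (P.root i))))

/-- `μ_z` of a word in the simple reflections, by the rules `μ_z(1) = 1` and
`μ_z(s w) = μ_z(w) μ_{wz}(s)`. -/
def muWord (b : P.Base) (z : Torus X) : List b.support → heckeAlgebra b
  | [] => 1
  | i :: l => muWord b z l * muSimple b (torusAct (wordProd b l) z) i

/-- `μ_z(w) ∈ 𝓗`, computed from a reduced word of `w`. -/
def mu [P.IsReduced] (b : P.Base) (z : Torus X) (w : P.weylGroup) : heckeAlgebra b :=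
  muWord b z (reducedWord b w)

/-- `m_{u,v}(z) = Λ(ψ_u μ_z(v))`. -/
def m [P.IsReduced] (b : P.Base) (z : Torus X) (u v : P.weylGroup) : Scalar := Lam b (psi b u * mu b z v)

/-- The deformed `R`-polynomial `r_{u,v}(z)`, defined by the expansion
`μ_z(v) = ∑_u q_u⁻¹ r̄_{u,v}(z) T_{u⁻¹}`. -/
def r [P.IsReduced] (b : P.Base) (z : Torus X) (u v : P.weylGroup) : Scalar :=
  bar (qpow b u * heckeCoeff b u⁻¹ (mu b z v))

/-- The matrix `(m_{u,v})` indexed by the Weyl group. -/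
def mMatrix [P.IsReduced] (b : P.Base) (z : Torus X) : Matrix P.weylGroup P.weylGroup Scalar :=
  Matrix.of (m b z)

/-- The matrix `(r_{u,v})` indexed by the Weyl group. -/
def rMatrix [P.IsReduced] (b : P.Base) (z : Torus X) : Matrix P.weylGroup P.weylGroup Scalar :=
  Matrix.of (r b z)

end CasselmanBasis

end

open RootPairing

namespace CasselmanBasis

set_option linter.unusedSectionVars false

variable {ι X Y : Type*} [Finite ι] [AddCommGroup X] [AddCommGroup Y] {P : RootDatum ι X Y}

/-! ### Positive roots, length and exchange -/

/-! Let `R` be the matrix whose entry `R_{u,v}` is `q_u` times the coefficient of `T_{u⁻¹}` in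
`μ_z(v)` (`rBar` below). The matrix `r` is the entrywise bar of `R`. Since `Λ(T_x h)` is `q_x` times
the coefficient of `T_{x⁻¹}` in `h`, also `m = ζ R` with `ζ` the zeta matrix of the Bruhat order.
For a matrix `a` put `a*_{u,v} = ε_u ε_v a_{w₀v,w₀u}`, so that `(ab)* = b* a*`. Left multiplication
by `w₀` reverses the Bruhat order, and by Verma's theorem its Möbius function is `ε_u ε_v`; hence
`ζ* = ζ⁻¹`. Both inverse formulas therefore follow from `R* R = 1`.

This last identity is an orthogonality relation in the regular representation. Let `⟨T_x, T_y⟩ = q_x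
δ_{x,y}` and let `θ` (`longTwist`) send `T_u` to `ε_{uw₀} q_{uw₀}⁻¹ T_{uw₀}`. Each `T_s` is
self-adjoint and `θ T_s = (q - 1 - T_s) θ`; as `c(a) = a/(1-a)` satisfies `c(a⁻¹) = -1 - c(a)`, `θ`
carries `μ_z(s)` to `-μ_{z⁻¹}(s)`. The sums in `R* R` are, up to a sign and a factor `q_{w₀}`, the
pairings `⟨μ_z(y) T_1, θ(μ_z(w₀x) T_1)⟩`. Moving `μ_z(y)` to the other side turns such a pairing
into that of `T_1` with a product of factors `μ(s)` along a word for `w₀xy⁻¹`, applied to `T_{w₀}`.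
Two adjacent factors for the same `s` multiply to a scalar, so the product is a multiple of one
along a reduced word, whose support is bounded by that word's element in the Bruhat order. The
pairing thus vanishes unless `x = y`, when the word is reduced and the leading coefficient is known.

Collapsing words requires that `μ_z(w)` not depend on the reduced word. Matsumoto's argument, based
on the exchange condition, reduces this to rank two, where it is a Yang–Baxter identity in each of
the types A₁ × A₁, A₂, B₂ and G₂. -/

theorem ofIdx_mul_self (i : ι) : weylGroup.ofIdx P i * weylGroup.ofIdx P i = 1 := by
  apply Subtype.ext
  change Equiv.reflection P i * Equiv.reflection P i = 1
  rw [mul_eq_one_iff_inv_eq, Equiv.reflection_inv P i]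

theorem ofIdx_inv (i : ι) : (weylGroup.ofIdx P i)⁻¹ = weylGroup.ofIdx P i :=
  inv_eq_of_mul_eq_one_left (ofIdx_mul_self i)

theorem perm_ofIdx (i : ι) : P.weylGroupToPerm (weylGroup.ofIdx P i) = P.reflectionPerm i := rfl

/-- Translates equalities between roots into equalities in the group. Both sides are compatible with
products in `w`, so generators suffice. -/
theorem ofIdx_perm (w : P.weylGroup) (i : ι) :
    weylGroup.ofIdx P (P.weylGroupToPerm w i) = w * weylGroup.ofIdx P i * w⁻¹ := by
  have hgen : ∀ i j, weylGroup.ofIdx P (P.reflectionPerm j i) =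
      weylGroup.ofIdx P j * weylGroup.ofIdx P i * (weylGroup.ofIdx P j)⁻¹ := by
    intro i j
    rw [ofIdx_inv]
    apply Subtype.ext
    apply Equiv.weightHom_injective P
    ext x
    change P.reflection (P.reflectionPerm j i) x =
      P.reflection j (P.reflection i (P.reflection j x))
    rw [reflection_reflectionPerm]
    rfl
  obtain ⟨g, hg⟩ := w
  induction hg using weylGroup.induction generalizing i with
  | mem j => exact hgen i j
  | one =>
    change weylGroup.ofIdx P (P.weylGroupToPerm 1 i) = 1 * weylGroup.ofIdx P i * 1⁻¹
    simp
  | mul g h hg hh ihg ihh =>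
    have : (⟨g * h, mul_mem hg hh⟩ : P.weylGroup) = ⟨g, hg⟩ * ⟨h, hh⟩ := rfl
    rw [this, map_mul, Equiv.Perm.mul_apply, ihg, ihh, mul_inv_rev]
    simp only [mul_assoc]

theorem isPos_reflectionPerm_self (b : P.Base) (i : ι) :
    b.IsPos (P.reflectionPerm i i) ↔ ¬ b.IsPos i :=
  Base.IsPos.neg_iff_not b i

theorem perm_reflectionPerm_self (w : P.weylGroup) (i : ι) :
    P.weylGroupToPerm w (P.reflectionPerm i i) =
      P.reflectionPerm (P.weylGroupToPerm w i) (P.weylGroupToPerm w i) := by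
  rw [← perm_ofIdx i, ← perm_ofIdx (P.weylGroupToPerm w i), ofIdx_perm,
    ← Equiv.Perm.mul_apply, ← Equiv.Perm.mul_apply, ← map_mul, ← map_mul, inv_mul_cancel_right]

theorem perm_mul_ofIdx_self (w : P.weylGroup) (i : ι) :
    P.weylGroupToPerm (w * weylGroup.ofIdx P i) i =
      P.reflectionPerm (P.weylGroupToPerm w i) (P.weylGroupToPerm w i) := by
  rw [map_mul, Equiv.Perm.mul_apply, perm_ofIdx, perm_reflectionPerm_self]

@[simp] theorem wordProd_nil (b : P.Base) : wordProd b [] = 1 := rfl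

@[simp] theorem wordProd_cons (b : P.Base) (i : b.support) (l : List b.support) :
    wordProd b (i :: l) = simpleRefl b i * wordProd b l := by simp [wordProd]

@[simp] theorem wordProd_append (b : P.Base) (l l' : List b.support) :
    wordProd b (l ++ l') = wordProd b l * wordProd b l' := by simp [wordProd]

@[simp] theorem simpleRefl_mul_self (b : P.Base) (i : b.support) :
    simpleRefl b i * simpleRefl b i = 1 := ofIdx_mul_self _

@[simp] theorem simpleRefl_mul_cancel (b : P.Base) (i : b.support) (w : P.weylGroup) :
    simpleRefl b i * (simpleRefl b i * w) = w := by
  rw [← mul_assoc, simpleRefl_mul_self, one_mul]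

@[simp] theorem mul_simpleRefl_cancel (b : P.Base) (i : b.support) (w : P.weylGroup) :
    w * simpleRefl b i * simpleRefl b i = w := by
  rw [mul_assoc, simpleRefl_mul_self, mul_one]

@[simp] theorem simpleRefl_inv (b : P.Base) (i : b.support) :
    (simpleRefl b i)⁻¹ = simpleRefl b i := ofIdx_inv _

theorem wordProd_reverse (b : P.Base) (l : List b.support) :
    wordProd b l.reverse = (wordProd b l)⁻¹ := by
  induction l with
  | nil => simp
  | cons i l ih => simp [ih]

theorem length_wordProd_le (b : P.Base) (l : List b.support) :
    length b (wordProd b l) ≤ l.length :=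
  Nat.sInf_le ⟨l, rfl, rfl⟩

@[simp] theorem length_one (b : P.Base) : length b (1 : P.weylGroup) = 0 :=
  Nat.le_zero.mp (length_wordProd_le b [])

variable [P.IsReduced]

/-- Strong exchange condition. The root `i` is positive but the whole word makes it negative, so
some letter `j` turns a positive root negative. A simple reflection does this only to its own simple
root, so the suffix after `j` carries `i` to `j`, and conjugating the reflection through that suffix
deletes the letter. -/
theorem wordProd_mul_ofIdx (b : P.Base) (l : List b.support) (i : ι) (hi : b.IsPos i)
    (h : ¬ b.IsPos (P.weylGroupToPerm (wordProd b l) i)) :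
    ∃ k < l.length, wordProd b l * weylGroup.ofIdx P i = wordProd b (l.eraseIdx k) := by
  induction l with
  | nil => simp [hi] at h
  | cons j l ih =>
    by_cases h' : b.IsPos (P.weylGroupToPerm (wordProd b l) i)
    · refine ⟨0, by simp, ?_⟩
      have hj : P.weylGroupToPerm (wordProd b l) i = j := by
        by_contra hne
        apply h
        rw [wordProd_cons, map_mul, Equiv.Perm.mul_apply]
        exact Base.IsPos.reflectionPerm h' j.2 hne
      have := ofIdx_perm (wordProd b l) i
      rw [hj] at this
      simp only [wordProd_cons, List.eraseIdx_cons_zero]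
      rw [show simpleRefl b j = _ from this]
      simp [mul_assoc, ofIdx_mul_self]
    · obtain ⟨k, hk, e⟩ := ih h'
      refine ⟨k + 1, by simpa using hk, ?_⟩
      simp [mul_assoc, e]

theorem length_mul_ofIdx_lt (b : P.Base) (w : P.weylGroup) (i : ι) (hi : b.IsPos i)
    (h : ¬ b.IsPos (P.weylGroupToPerm w i)) : length b (w * weylGroup.ofIdx P i) < length b w := by
  obtain ⟨l, rfl, hl⟩ := exists_reducedWord b w
  obtain ⟨k, hk, e⟩ := wordProd_mul_ofIdx b l i hi h
  rw [e, ← hl]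
  have := length_wordProd_le b (l.eraseIdx k)
  rw [List.length_eraseIdx_of_lt hk] at this
  omega

/-- This is the preceding inequality applied to `w s_α`, which sends `α` to `-wα`. -/
theorem lt_length_mul_ofIdx (b : P.Base) (w : P.weylGroup) (i : ι) (hi : b.IsPos i)
    (h : b.IsPos (P.weylGroupToPerm w i)) : length b w < length b (w * weylGroup.ofIdx P i) := by
  have := length_mul_ofIdx_lt b (w * weylGroup.ofIdx P i) i hi (by
    rw [perm_mul_ofIdx_self, isPos_reflectionPerm_self]; simpa)
  rwa [mul_assoc, ofIdx_mul_self, mul_one] at this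

theorem length_lt_mul_ofIdx_iff (b : P.Base) (w : P.weylGroup) (i : ι) (hi : b.IsPos i) :
    length b w < length b (w * weylGroup.ofIdx P i) ↔ b.IsPos (P.weylGroupToPerm w i) := by
  refine ⟨fun h => ?_, lt_length_mul_ofIdx b w i hi⟩
  by_contra h'
  exact absurd (length_mul_ofIdx_lt b w i hi h') (by omega)

@[simp] theorem length_inv (b : P.Base) (w : P.weylGroup) : length b w⁻¹ = length b w := by
  have key : ∀ w : P.weylGroup, length b w⁻¹ ≤ length b w := fun w => by
    obtain ⟨l, rfl, hl⟩ := exists_reducedWord b w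
    rw [← hl, ← wordProd_reverse]
    simpa using length_wordProd_le b l.reverse
  exact le_antisymm (key w) (by simpa using key w⁻¹)

theorem length_mul_le (b : P.Base) (w w' : P.weylGroup) :
    length b (w * w') ≤ length b w + length b w' := by
  obtain ⟨l, rfl, hl⟩ := exists_reducedWord b w
  obtain ⟨l', rfl, hl'⟩ := exists_reducedWord b w'
  rw [← hl, ← hl', ← wordProd_append, ← List.length_append]
  exact length_wordProd_le b _

theorem length_simpleRefl_le (b : P.Base) (i : b.support) : length b (simpleRefl b i) ≤ 1 := by
  simpa using length_wordProd_le b [i]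

theorem eq_one_of_length_eq_zero (b : P.Base) (w : P.weylGroup) (h : length b w = 0) : w = 1 := by
  obtain ⟨l, rfl, hl⟩ := exists_reducedWord b w
  rw [h, List.length_eq_zero_iff] at hl
  simp [hl]

theorem length_lt_mul_simpleRefl_iff (b : P.Base) (w : P.weylGroup) (i : b.support) :
    length b w < length b (w * simpleRefl b i) ↔ b.IsPos (P.weylGroupToPerm w i) :=
  length_lt_mul_ofIdx_iff b w i (Base.isPos_of_mem_support i.2)

/-- Subadditivity bounds the change of length by one; the sign of the image of the simple root
decides its direction. -/
theorem length_mul_simpleRefl (b : P.Base) (w : P.weylGroup) (i : b.support) :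
    (length b (w * simpleRefl b i) = length b w + 1 ∧ b.IsPos (P.weylGroupToPerm w i)) ∨
    (length b w = length b (w * simpleRefl b i) + 1 ∧ ¬ b.IsPos (P.weylGroupToPerm w i)) := by
  have h1 := length_mul_le b w (simpleRefl b i)
  have h2 := length_mul_le b (w * simpleRefl b i) (simpleRefl b i)
  have h3 := length_simpleRefl_le b i
  rw [mul_simpleRefl_cancel] at h2
  by_cases h : b.IsPos (P.weylGroupToPerm w i)
  · left
    have := lt_length_mul_ofIdx b w i (Base.isPos_of_mem_support i.2) h
    exact ⟨by change length b w < length b (w * simpleRefl b i) at this; omega, h⟩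
  · right
    have := length_mul_ofIdx_lt b w i (Base.isPos_of_mem_support i.2) h
    exact ⟨by change length b (w * simpleRefl b i) < length b w at this; omega, h⟩

theorem length_simpleRefl_mul (b : P.Base) (w : P.weylGroup) (i : b.support) :
    (length b (simpleRefl b i * w) = length b w + 1 ∧ b.IsPos (P.weylGroupToPerm w⁻¹ i)) ∨
    (length b w = length b (simpleRefl b i * w) + 1 ∧
      ¬ b.IsPos (P.weylGroupToPerm w⁻¹ i)) := by
  have h : length b (simpleRefl b i * w) = length b (w⁻¹ * simpleRefl b i) := by
    rw [← length_inv, mul_inv_rev, simpleRefl_inv]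
  rw [h, ← length_inv b w]
  exact length_mul_simpleRefl b w⁻¹ i

/-- Exchange condition on the left. -/
theorem simpleRefl_mul_wordProd (b : P.Base) (l : List b.support) (i : b.support)
    (h : length b (simpleRefl b i * wordProd b l) < length b (wordProd b l)) :
    ∃ k < l.length, simpleRefl b i * wordProd b l = wordProd b (l.eraseIdx k) := by
  -- The root supplied is `-w⁻¹αᵢ`: it is positive because `sᵢ` shortens `w`, and `w` sends it to
  -- the negative root `-αᵢ`.
  obtain ⟨k, hk, e⟩ := wordProd_mul_ofIdx b l (P.weylGroupToPerm (wordProd b l)⁻¹ (P.reflectionPerm i i))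
    (by
      rw [perm_reflectionPerm_self, isPos_reflectionPerm_self]
      rcases length_simpleRefl_mul b (wordProd b l) i with h' | h'
      · omega
      · exact h'.2)
    (by
      rw [← Equiv.Perm.mul_apply, ← map_mul, mul_inv_cancel, map_one, Equiv.Perm.one_apply,
        isPos_reflectionPerm_self, not_not]
      exact Base.isPos_of_mem_support i.2)
  refine ⟨k, hk, ?_⟩
  rw [← e, ofIdx_perm]
  have := ofIdx_perm (simpleRefl b i) (i : ι)
  rw [simpleRefl, perm_ofIdx] at this
  rw [this, ofIdx_mul_self, one_mul, ofIdx_inv]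
  simp [mul_assoc, simpleRefl]

/-- A word is reduced if its length is the length of its product. -/
def IsReducedWord (b : P.Base) (l : List b.support) : Prop := length b (wordProd b l) = l.length

theorem isReducedWord_reducedWord (b : P.Base) (w : P.weylGroup) :
    IsReducedWord b (reducedWord b w) := by
  obtain ⟨h1, h2⟩ := (exists_reducedWord b w).choose_spec
  unfold IsReducedWord reducedWord
  rw [h1, h2]

@[simp] theorem wordProd_reducedWord (b : P.Base) (w : P.weylGroup) :
    wordProd b (reducedWord b w) = w := (exists_reducedWord b w).choose_spec.1

@[simp] theorem length_reducedWord (b : P.Base) (w : P.weylGroup) :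
    (reducedWord b w).length = length b w := (exists_reducedWord b w).choose_spec.2

theorem IsReducedWord.of_append_right {b : P.Base} {l l' : List b.support}
    (h : IsReducedWord b (l ++ l')) : IsReducedWord b l' := by
  have h1 := length_mul_le b (wordProd b l) (wordProd b l')
  have h2 := length_wordProd_le b l
  have h3 := length_wordProd_le b l'
  rw [IsReducedWord, wordProd_append, List.length_append] at h
  rw [IsReducedWord]; omega

theorem IsReducedWord.of_append_left {b : P.Base} {l l' : List b.support}
    (h : IsReducedWord b (l ++ l')) : IsReducedWord b l := by
  have h1 := length_mul_le b (wordProd b l) (wordProd b l')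
  have h2 := length_wordProd_le b l
  have h3 := length_wordProd_le b l'
  rw [IsReducedWord, wordProd_append, List.length_append] at h
  rw [IsReducedWord]; omega

theorem IsReducedWord.of_cons {b : P.Base} {i : b.support} {l : List b.support}
    (h : IsReducedWord b (i :: l)) : IsReducedWord b l :=
  IsReducedWord.of_append_right (l := [i]) h

theorem IsReducedWord.length_lt {b : P.Base} {i : b.support} {l : List b.support}
    (h : IsReducedWord b (i :: l)) :
    length b (wordProd b l) < length b (simpleRefl b i * wordProd b l) := by
  have h2 := h.of_cons
  rw [IsReducedWord] at h h2
  rw [← wordProd_cons, h, h2]; simp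

theorem IsReducedWord.cons {b : P.Base} {i : b.support} {l : List b.support}
    (h : IsReducedWord b l)
    (h' : length b (wordProd b l) < length b (simpleRefl b i * wordProd b l)) :
    IsReducedWord b (i :: l) := by
  rw [IsReducedWord] at h ⊢
  rcases length_simpleRefl_mul b (wordProd b l) i with h1 | h1
  · simp [h1.1, h]
  · omega

theorem eps_simpleRefl_mul (b : P.Base) (i : b.support) (w : P.weylGroup) :
    eps b (simpleRefl b i * w) = - eps b w := by
  unfold eps
  rcases length_simpleRefl_mul b w i with h | h
  · rw [h.1, pow_succ]; ring
  · rw [h.1, pow_succ]; ring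

theorem eps_mul_self (b : P.Base) (w : P.weylGroup) : eps b w * eps b w = 1 := by
  rw [eps, ← mul_pow]; simp

theorem eps_inv (b : P.Base) (w : P.weylGroup) : eps b w⁻¹ = eps b w := by simp [eps]

theorem eps_mul (b : P.Base) (w w' : P.weylGroup) : eps b (w * w') = eps b w * eps b w' := by
  obtain ⟨l, rfl⟩ := exists_word b w
  induction l with
  | nil => simp [eps]
  | cons i l ih => rw [wordProd_cons, mul_assoc, eps_simpleRefl_mul, eps_simpleRefl_mul, ih]; ring

/-! ### The long element -/

theorem length_le_longElement (b : P.Base) (w : P.weylGroup) :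
    length b w ≤ length b (longElement b) := (exists_longest b).choose_spec w

/-- By maximality `w₀` makes every positive root negative. Hence each letter that lengthens `w` on
the right shortens `w₀w`, and the sum stays constant along a reduced word. -/
theorem length_longElement_mul_add (b : P.Base) (w : P.weylGroup) :
    length b (longElement b * w) + length b w = length b (longElement b) := by
  have hneg : ∀ i, b.IsPos i → ¬ b.IsPos (P.weylGroupToPerm (longElement b) i) := fun i hi h =>
    absurd (lt_length_mul_ofIdx b _ i hi h) (by have := length_le_longElement b
                                                  (longElement b * weylGroup.ofIdx P i); omega)
  obtain ⟨l, rfl, hl⟩ := exists_reducedWord b w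
  replace hl : IsReducedWord b l := hl.symm
  induction l using List.reverseRecOn with
  | nil => simp
  | append_singleton l i ih =>
    have h1 := hl.of_append_left
    specialize ih h1
    rw [IsReducedWord, wordProd_append, List.length_append] at hl
    rw [IsReducedWord] at h1
    simp only [wordProd_cons, wordProd_nil, mul_one, List.length_singleton] at hl
    rw [wordProd_append, ← mul_assoc]
    simp only [wordProd_cons, wordProd_nil, mul_one]
    rcases length_mul_simpleRefl b (wordProd b l) i with h | h
    · rcases length_mul_simpleRefl b (longElement b * wordProd b l) i with h' | h'
      · refine absurd ?_ (hneg _ h.2)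
        have := h'.2
        rwa [map_mul, Equiv.Perm.mul_apply] at this
      · omega
    · omega

theorem longElement_mul_self (b : P.Base) : longElement b * longElement b = 1 := by
  apply eq_one_of_length_eq_zero b
  have := length_longElement_mul_add b (longElement b)
  omega

theorem longElement_inv (b : P.Base) : (longElement b)⁻¹ = longElement b :=
  inv_eq_of_mul_eq_one_left (longElement_mul_self b)

@[simp] theorem longElement_mul_cancel (b : P.Base) (w : P.weylGroup) :
    longElement b * (longElement b * w) = w := by
  rw [← mul_assoc, longElement_mul_self, one_mul]

theorem length_mul_longElement_add (b : P.Base) (w : P.weylGroup) :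
    length b (w * longElement b) + length b w = length b (longElement b) := by
  have := length_longElement_mul_add b w⁻¹
  rwa [← longElement_inv, ← mul_inv_rev, length_inv, length_inv, longElement_inv] at this

/-! ### The Bruhat order -/

theorem bruhatLE_refl (b : P.Base) (u : P.weylGroup) : bruhatLE b u u := Relation.ReflTransGen.refl

theorem bruhatLE_trans {b : P.Base} {u v w : P.weylGroup} (h : bruhatLE b u v)
    (h' : bruhatLE b v w) : bruhatLE b u w := Relation.ReflTransGen.trans h h'

theorem eq_or_length_lt_of_bruhatLE {b : P.Base} {u v : P.weylGroup} (h : bruhatLE b u v) :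
    u = v ∨ length b u < length b v := by
  induction h with
  | refl => exact Or.inl rfl
  | tail _ h ih =>
    obtain ⟨i, -, hl⟩ := h
    rcases ih with rfl | ih
    · exact Or.inr hl
    · exact Or.inr (ih.trans hl)

theorem bruhatLE_antisymm {b : P.Base} {u v : P.weylGroup} (h : bruhatLE b u v)
    (h' : bruhatLE b v u) : u = v := by
  rcases eq_or_length_lt_of_bruhatLE h with h1 | h1
  · exact h1
  rcases eq_or_length_lt_of_bruhatLE h' with h2 | h2
  · exact h2.symm
  omega

/-- The order is defined by reflections on the right; `s w = w t` with `t` the reflection in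
`w⁻¹α_s` makes a left multiplication such a step. -/
theorem bruhatLE_simpleRefl_mul {b : P.Base} {i : b.support} {w : P.weylGroup}
    (h : length b w < length b (simpleRefl b i * w)) : bruhatLE b w (simpleRefl b i * w) := by
  refine Relation.ReflTransGen.single ⟨P.weylGroupToPerm w⁻¹ i, ?_, h⟩
  rw [ofIdx_perm]
  simp [simpleRefl, mul_assoc]

theorem simpleRefl_mul_bruhatLE {b : P.Base} {i : b.support} {w : P.weylGroup}
    (h : length b (simpleRefl b i * w) < length b w) : bruhatLE b (simpleRefl b i * w) w := by
  have := bruhatLE_simpleRefl_mul (b := b) (i := i) (w := simpleRefl b i * w) (by simpa)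
  rwa [simpleRefl_mul_cancel] at this

theorem length_simpleRefl_mul_ne (b : P.Base) (i : b.support) (w : P.weylGroup) :
    length b (simpleRefl b i * w) ≠ length b w := by
  rcases length_simpleRefl_mul b w i with h | h <;> omega

/-- A covering step `x < x t` of the Bruhat order is either `x < s x` or is carried by `s`
to the step `s x < s x t`. -/
theorem simpleRefl_mul_step {b : P.Base} (s : b.support) {x y : P.weylGroup}
    (h : ∃ i : ι, y = x * weylGroup.ofIdx P i ∧ length b x < length b y) :
    simpleRefl b s * x = y ∨ bruhatLE b (simpleRefl b s * x) (simpleRefl b s * y) := by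
  obtain ⟨i, rfl, hl⟩ := h
  -- A root and its negative define the same reflection.
  wlog hi : b.IsPos i generalizing i
  · have e : weylGroup.ofIdx P (P.reflectionPerm i i) = weylGroup.ofIdx P i := by
      have := ofIdx_perm (weylGroup.ofIdx P i) i
      rw [perm_ofIdx] at this
      rw [this, ofIdx_mul_self, one_mul, ofIdx_inv]
    rw [← e] at hl ⊢
    exact this _ hl ((isPos_reflectionPerm_self b i).mpr hi)
  rw [length_lt_mul_ofIdx_iff b x i hi] at hl
  -- If `x` sends the root to `α_s`, then `x t = s x`. Otherwise `s` keeps its positive image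
  -- positive, so the step survives multiplication by `s`.
  by_cases hs : P.weylGroupToPerm x i = s
  · left
    have := ofIdx_perm x i
    rw [hs] at this
    rw [show simpleRefl b s = _ from this]
    simp
  · right
    refine Relation.ReflTransGen.single ⟨i, (mul_assoc _ _ _).symm, ?_⟩
    rw [← mul_assoc, length_lt_mul_ofIdx_iff b _ i hi, map_mul, Equiv.Perm.mul_apply]
    exact Base.IsPos.reflectionPerm hl s.2 hs

/-- Lifting property. Multiply a chain from `u` to `v` by `s`: either a step of the chain is itself
`x < s x`, and the rest of the original chain finishes, or every step is carried along until `s v <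
v`. -/
theorem simpleRefl_mul_bruhatLE_of_lt {b : P.Base} {s : b.support} {u v : P.weylGroup}
    (hv : length b (simpleRefl b s * v) < length b v) (h : bruhatLE b u v) :
    bruhatLE b (simpleRefl b s * u) v := by
  induction h using Relation.ReflTransGen.head_induction_on with
  | refl => exact simpleRefl_mul_bruhatLE hv
  | head h h' ih =>
    rcases simpleRefl_mul_step s h with e | e
    · rw [e]; exact h'
    · exact bruhatLE_trans e ih

theorem bruhatLE_simpleRefl_mul_of_lt {b : P.Base} {s : b.support} {u v : P.weylGroup}
    (hu : length b u < length b (simpleRefl b s * u)) (h : bruhatLE b u v) :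
    bruhatLE b u (simpleRefl b s * v) := by
  induction h with
  | refl => exact bruhatLE_simpleRefl_mul hu
  | tail h' h ih =>
    rcases simpleRefl_mul_step s h with e | e
    · rw [← e, simpleRefl_mul_cancel]; exact h'
    · exact bruhatLE_trans ih e

theorem simpleRefl_mul_bruhatLE_simpleRefl_mul {b : P.Base} {s : b.support} {u v : P.weylGroup}
    (hv : length b v < length b (simpleRefl b s * v)) (h : bruhatLE b u v) :
    bruhatLE b (simpleRefl b s * u) (simpleRefl b s * v) :=
  simpleRefl_mul_bruhatLE_of_lt (by simpa) (bruhatLE_trans h (bruhatLE_simpleRefl_mul hv))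

/-- Left multiplication by `w₀` commutes with reflections on the right and complements lengths, so
it reverses every step. -/
theorem longElement_mul_bruhatLE {b : P.Base} {u v : P.weylGroup} (h : bruhatLE b u v) :
    bruhatLE b (longElement b * v) (longElement b * u) := by
  induction h with
  | refl => exact bruhatLE_refl _ _
  | @tail x y _ h ih =>
    refine bruhatLE_trans (Relation.ReflTransGen.single ?_) ih
    obtain ⟨i, rfl, hl⟩ := h
    refine ⟨i, by simp [mul_assoc, ofIdx_mul_self], ?_⟩
    have h1 := length_longElement_mul_add b x
    have h2 := length_longElement_mul_add b (x * weylGroup.ofIdx P i)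
    omega

theorem longElement_mul_bruhatLE_iff {b : P.Base} {u v : P.weylGroup} :
    bruhatLE b (longElement b * v) (longElement b * u) ↔ bruhatLE b u v :=
  ⟨fun h => by simpa using longElement_mul_bruhatLE h, longElement_mul_bruhatLE⟩

theorem mem_bruhatIcc {b : P.Base} {u v x : P.weylGroup} :
    x ∈ bruhatIcc b u v ↔ bruhatLE b u x ∧ bruhatLE b x v := by
  simp [bruhatIcc]

theorem exists_simpleRefl_mul_lt (b : P.Base) (w : P.weylGroup) (hw : w ≠ 1) :
    ∃ s, length b (simpleRefl b s * w) < length b w := by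
  have h := isReducedWord_reducedWord b w
  have e := wordProd_reducedWord b w
  rcases hl : reducedWord b w with _ | ⟨s, l⟩
  · rw [hl] at e; exact absurd e.symm hw
  · rw [hl] at e h
    refine ⟨s, ?_⟩
    have := h.length_lt
    rw [← e]
    simpa using this

/-- By the two lifting properties `x ↦ s x` preserves the interval, and it changes the sign. -/
theorem sum_eps_bruhatIcc_of_lt {b : P.Base} {s : b.support} {u v : P.weylGroup}
    (hu : length b u < length b (simpleRefl b s * u))
    (hv : length b (simpleRefl b s * v) < length b v) :
    ∑ x ∈ bruhatIcc b u v, eps b x = 0 := by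
  refine Finset.sum_involution (fun x _ => simpleRefl b s * x) ?_ ?_ ?_ ?_
  · intro x _
    rw [eps_simpleRefl_mul, add_neg_cancel]
  · intro x _ _ h
    exact length_simpleRefl_mul_ne b s x (congrArg (length b) h)
  · intro x hx
    rw [mem_bruhatIcc] at hx ⊢
    exact ⟨bruhatLE_simpleRefl_mul_of_lt hu hx.1, simpleRefl_mul_bruhatLE_of_lt hv hx.2⟩
  · intro x _
    exact simpleRefl_mul_cancel b s x

/-- Verma's theorem: the Möbius function of the Bruhat order is `ε_u ε_v`. -/
theorem sum_eps_bruhatIcc (b : P.Base) (u v : P.weylGroup) (huv : u ≠ v) :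
    ∑ x ∈ bruhatIcc b u v, eps b x = 0 := by
  classical
  induction hn : length b v using Nat.strong_induction_on generalizing u v with
  | _ n ih =>
  by_cases huv' : bruhatLE b u v
  swap
  · rw [Finset.sum_eq_zero]
    intro x hx
    rw [mem_bruhatIcc] at hx
    exact absurd (bruhatLE_trans hx.1 hx.2) huv'
  have hv1 : v ≠ 1 := by
    rintro rfl
    rcases eq_or_length_lt_of_bruhatLE huv' with h | h
    · exact huv h
    · simp at h
  obtain ⟨s, hs⟩ := exists_simpleRefl_mul_lt b v hv1
  -- If `u < su` the involution applies at once. If `su < u`, it applies to `[su, v]`, while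
  -- induction handles `[su, sv]` and `[u, sv]`; comparing these three sums gives `[u, v]`.
  rcases lt_or_gt_of_ne (length_simpleRefl_mul_ne b s u) with hu | hu
  swap
  · exact sum_eps_bruhatIcc_of_lt hu hs
  have h0 : ∑ x ∈ bruhatIcc b (simpleRefl b s * u) v, eps b x = 0 :=
    sum_eps_bruhatIcc_of_lt (s := s) (by simpa using hu) hs
  have h1 : ∑ x ∈ bruhatIcc b (simpleRefl b s * u) (simpleRefl b s * v), eps b x = 0 :=
    ih _ (hn ▸ hs) _ _ (fun h => huv (mul_left_cancel h)) rfl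
  have h2 : ∑ x ∈ bruhatIcc b u (simpleRefl b s * v), eps b x = 0 :=
    ih _ (hn ▸ hs) _ _ (by rintro rfl; rw [simpleRefl_mul_cancel] at hu; omega) rfl
  have hfilter : ∀ w, (bruhatIcc b (simpleRefl b s * u) w).filter (fun x => bruhatLE b u x) =
      bruhatIcc b u w := by
    intro w
    ext x
    simp only [Finset.mem_filter, mem_bruhatIcc]
    exact ⟨fun h => ⟨h.2, h.1.2⟩, fun h => ⟨⟨bruhatLE_trans (simpleRefl_mul_bruhatLE hu) h.1, h.2⟩,
      h.1⟩⟩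
  -- An `x` above `su` but not above `u` satisfies `x < sx`, since otherwise lifting gives `u ≤ x`.
  -- Hence for such `x` the conditions `x ≤ v` and `x ≤ sv` agree.
  have hcompl : (bruhatIcc b (simpleRefl b s * u) v).filter (fun x => ¬ bruhatLE b u x) =
      (bruhatIcc b (simpleRefl b s * u) (simpleRefl b s * v)).filter
        (fun x => ¬ bruhatLE b u x) := by
    ext x
    simp only [Finset.mem_filter, mem_bruhatIcc]
    constructor
    · rintro ⟨⟨hux, hxv⟩, hx⟩
      refine ⟨⟨hux, bruhatLE_simpleRefl_mul_of_lt ?_ hxv⟩, hx⟩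
      rcases lt_or_gt_of_ne (length_simpleRefl_mul_ne b s x) with h | h
      · exact absurd (by simpa using simpleRefl_mul_bruhatLE_of_lt h hux) hx
      · exact h
    · rintro ⟨⟨hux, hxv⟩, hx⟩
      exact ⟨⟨hux, bruhatLE_trans hxv (simpleRefl_mul_bruhatLE hs)⟩, hx⟩
  rw [← Finset.sum_filter_add_sum_filter_not _ (fun x => bruhatLE b u x), hfilter] at h0 h1
  rw [hcompl] at h0
  rw [h2, zero_add] at h1
  rwa [h1, add_zero] at h0

/-! ### The regular representation of the Hecke algebra -/

theorem q_ne_zero : (q : Scalar) ≠ 0 := RatFunc.X_ne_zero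

theorem qpow_ne_zero (b : P.Base) (w : P.weylGroup) : qpow b w ≠ 0 := pow_ne_zero _ q_ne_zero

theorem heckeGenMul_single_of_lt {b : P.Base} {i : b.support} {w : P.weylGroup}
    (h : length b w < length b (simpleRefl b i * w)) :
    heckeGenMul b i (Finsupp.single w 1) = Finsupp.single (simpleRefl b i * w) 1 := by
  simp [heckeGenMul, h]

theorem heckeGenMul_single_of_gt {b : P.Base} {i : b.support} {w : P.weylGroup}
    (h : length b (simpleRefl b i * w) < length b w) :
    heckeGenMul b i (Finsupp.single w 1) =
      (q - 1) • Finsupp.single w 1 + q • Finsupp.single (simpleRefl b i * w) 1 := by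
  simp [heckeGenMul, h.not_gt]

/-- Right multiplication by `T_s` on the regular representation. -/
noncomputable def heckeRightMul (b : P.Base) (i : b.support) : Module.End Scalar (HeckeModule P) :=
  Finsupp.linearCombination Scalar fun w : P.weylGroup =>
    if length b w < length b (w * simpleRefl b i) then
      Finsupp.single (w * simpleRefl b i) (1 : Scalar)
    else (q - 1) • Finsupp.single w 1 + q • Finsupp.single (w * simpleRefl b i) 1

theorem heckeRightMul_single_of_lt {b : P.Base} {i : b.support} {w : P.weylGroup}
    (h : length b w < length b (w * simpleRefl b i)) :
    heckeRightMul b i (Finsupp.single w 1) = Finsupp.single (w * simpleRefl b i) 1 := by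
  simp [heckeRightMul, h]

theorem heckeRightMul_single_of_gt {b : P.Base} {i : b.support} {w : P.weylGroup}
    (h : length b (w * simpleRefl b i) < length b w) :
    heckeRightMul b i (Finsupp.single w 1) =
      (q - 1) • Finsupp.single w 1 + q • Finsupp.single (w * simpleRefl b i) 1 := by
  rw [heckeRightMul, Finsupp.linearCombination_single, one_smul, if_neg h.not_gt]

theorem length_lt_simpleRefl_mul_iff (b : P.Base) (w : P.weylGroup) (i : b.support) :
    length b w < length b (simpleRefl b i * w) ↔ b.IsPos (P.weylGroupToPerm w⁻¹ i) := by
  rw [← length_lt_mul_simpleRefl_iff, length_inv, ← length_inv b (simpleRefl b i * w)]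
  simp

theorem simpleRefl_mul_eq_mul_simpleRefl {b : P.Base} {i j : b.support} {w : P.weylGroup}
    (h : P.weylGroupToPerm w⁻¹ i = j) : simpleRefl b i * w = w * simpleRefl b j := by
  have := ofIdx_perm w⁻¹ i
  rw [h] at this
  rw [show simpleRefl b j = _ from this]
  simp [simpleRefl, mul_assoc]

/-- The left length comparison is the sign of `w⁻¹αᵢ`. Applying `sⱼ` preserves positivity except for
`αⱼ` itself, and `w⁻¹αᵢ = αⱼ` is the excluded equality `sᵢw = wsⱼ`. -/
theorem length_lt_simpleRefl_mul_mul_iff {b : P.Base} {i j : b.support} {w : P.weylGroup}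
    (h : simpleRefl b i * w ≠ w * simpleRefl b j) :
    length b (w * simpleRefl b j) < length b (simpleRefl b i * (w * simpleRefl b j)) ↔
      length b w < length b (simpleRefl b i * w) := by
  have key : ∀ w : P.weylGroup, simpleRefl b i * w ≠ w * simpleRefl b j →
      length b w < length b (simpleRefl b i * w) →
      length b (w * simpleRefl b j) < length b (simpleRefl b i * (w * simpleRefl b j)) := by
    intro w h hl
    rw [length_lt_simpleRefl_mul_iff] at hl ⊢
    rw [mul_inv_rev, simpleRefl_inv, map_mul, Equiv.Perm.mul_apply]
    exact Base.IsPos.reflectionPerm hl j.2 (fun e => h (simpleRefl_mul_eq_mul_simpleRefl e))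
  refine ⟨fun hl => ?_, key w h⟩
  have := key (w * simpleRefl b j) (by
    rw [mul_simpleRefl_cancel, ← mul_assoc]
    intro e
    refine h ?_
    rw [← mul_left_cancel_iff (a := simpleRefl b i), simpleRefl_mul_cancel, ← mul_assoc, e]) hl
  rwa [mul_simpleRefl_cancel] at this

theorem length_lt_mul_mul_simpleRefl_iff {b : P.Base} {i j : b.support} {w : P.weylGroup}
    (h : simpleRefl b i * w ≠ w * simpleRefl b j) :
    length b (simpleRefl b i * w) < length b (simpleRefl b i * w * simpleRefl b j) ↔
      length b w < length b (w * simpleRefl b j) := by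
  have := length_lt_simpleRefl_mul_mul_iff (b := b) (i := j) (j := i) (w := w⁻¹) (by
    intro e
    have := congrArg (·⁻¹) e
    simp at this
    exact h this.symm)
  rw [← length_inv b w, ← length_inv b (w * simpleRefl b j), ← length_inv b (simpleRefl b i * w),
    ← length_inv b (simpleRefl b i * w * simpleRefl b j)]
  simpa using this

/-- This carries the associativity of the Hecke algebra. If `sᵢw = wsⱼ`, left and right
multiplication act identically on `T_w` and `T_{sᵢw}`. Otherwise the left and right length
comparisons do not affect each other, and the four cases match term by term. -/
theorem heckeGenMul_comm_heckeRightMul (b : P.Base) (i j : b.support) :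
    Commute (heckeGenMul b i) (heckeRightMul b j) := by
  refine Finsupp.lhom_ext' fun w => LinearMap.ext_ring ?_
  simp only [LinearMap.comp_apply, Finsupp.lsingle_apply, Module.End.mul_apply]
  have neL := length_simpleRefl_mul_ne b i w
  by_cases e : simpleRefl b i * w = w * simpleRefl b j
  · rcases lt_or_gt_of_ne neL with h | h
    · have h' := h
      rw [e] at h'
      rw [heckeRightMul_single_of_gt h', heckeGenMul_single_of_gt h]
      have h2 : length b (simpleRefl b i * w) < length b (simpleRefl b i * (simpleRefl b i * w)) := by
        simpa using h
      have h3 : length b (w * simpleRefl b j) < length b (w * simpleRefl b j * simpleRefl b j) := by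
        simpa using h'
      simp only [map_add, map_smul]
      rw [heckeRightMul_single_of_gt h', heckeGenMul_single_of_gt h, ← e,
        heckeGenMul_single_of_lt h2, e, heckeRightMul_single_of_lt h3, ← e, simpleRefl_mul_cancel,
        e, mul_simpleRefl_cancel]
    · have h' := h
      rw [e] at h'
      rw [heckeRightMul_single_of_lt h', heckeGenMul_single_of_lt h]
      have h2 : length b (simpleRefl b i * (simpleRefl b i * w)) < length b (simpleRefl b i * w) := by
        simpa using h
      have h3 : length b (w * simpleRefl b j * simpleRefl b j) < length b (w * simpleRefl b j) := by
        simpa using h'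
      rw [← e, heckeGenMul_single_of_gt h2, e, heckeRightMul_single_of_gt h3, ← e,
        simpleRefl_mul_cancel, e, mul_simpleRefl_cancel]
  · have neR : length b (w * simpleRefl b j) ≠ length b w := by
      rcases length_mul_simpleRefl b w j with h | h <;> omega
    have iL := length_lt_simpleRefl_mul_mul_iff e
    have iR := length_lt_mul_mul_simpleRefl_iff e
    have neL' := length_simpleRefl_mul_ne b i (w * simpleRefl b j)
    have neR' : length b (simpleRefl b i * w * simpleRefl b j) ≠ length b (simpleRefl b i * w) := by
      rcases length_mul_simpleRefl b (simpleRefl b i * w) j with h | h <;> omega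
    rcases lt_or_gt_of_ne neL with hL | hL <;> rcases lt_or_gt_of_ne neR with hR | hR
    · have hL' := lt_of_le_of_ne (not_lt.mp fun h => absurd (iL.mp h) (by omega)) neL'
      have hR' := lt_of_le_of_ne (not_lt.mp fun h => absurd (iR.mp h) (by omega)) neR'
      rw [heckeRightMul_single_of_gt hR, heckeGenMul_single_of_gt hL]
      simp only [map_add, map_smul]
      rw [heckeRightMul_single_of_gt hR, heckeGenMul_single_of_gt hL, heckeGenMul_single_of_gt hL',
        heckeRightMul_single_of_gt hR', mul_assoc]
      simp only [smul_add, smul_smul, mul_comm q]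
      abel
    · have hL' := lt_of_le_of_ne (not_lt.mp fun h => absurd (iL.mp h) (by omega)) neL'
      have hR' := iR.mpr hR
      rw [heckeRightMul_single_of_lt hR, heckeGenMul_single_of_gt hL]
      simp only [map_add, map_smul]
      rw [heckeRightMul_single_of_lt hR, heckeGenMul_single_of_gt hL',
        heckeRightMul_single_of_lt hR', mul_assoc]
    · have hL' := iL.mpr hL
      have hR' := lt_of_le_of_ne (not_lt.mp fun h => absurd (iR.mp h) (by omega)) neR'
      rw [heckeRightMul_single_of_gt hR, heckeGenMul_single_of_lt hL]
      simp only [map_add, map_smul]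
      rw [heckeGenMul_single_of_lt hL, heckeGenMul_single_of_lt hL',
        heckeRightMul_single_of_gt hR', mul_assoc]
    · have hL' := iL.mpr hL
      have hR' := iR.mpr hR
      rw [heckeRightMul_single_of_lt hR, heckeGenMul_single_of_lt hL,
        heckeGenMul_single_of_lt hL', heckeRightMul_single_of_lt hR', mul_assoc]

theorem heckeAlgebra_comm_heckeRightMul (b : P.Base) (j : b.support) (h : heckeAlgebra b) :
    Commute (h : Module.End Scalar (HeckeModule P)) (heckeRightMul b j) := by
  obtain ⟨h, hh⟩ := h
  induction hh using Algebra.adjoin_induction with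
  | mem x hx => obtain ⟨i, rfl⟩ := hx; exact heckeGenMul_comm_heckeRightMul b i j
  | algebraMap r => exact Algebra.commute_algebraMap_left r _
  | add x y _ _ hx hy => exact Commute.add_left hx hy
  | mul x y _ _ hx hy => exact Commute.mul_left hx hy

/-- An element of the Hecke algebra is determined by its value at `T_1`. -/
theorem heckeAlgebra_ext {b : P.Base} {h h' : heckeAlgebra b}
    (e : (h : Module.End Scalar (HeckeModule P)) (Finsupp.single 1 1) =
      (h' : Module.End Scalar (HeckeModule P)) (Finsupp.single 1 1)) : h = h' := by
  apply Subtype.ext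
  refine Finsupp.lhom_ext' fun w => LinearMap.ext_ring ?_
  simp only [LinearMap.comp_apply, Finsupp.lsingle_apply]
  obtain ⟨l, rfl, hl⟩ := exists_reducedWord b w
  replace hl : IsReducedWord b l := hl.symm
  induction l using List.reverseRecOn with
  | nil => exact e
  | append_singleton l i ih =>
    have h1 := hl.of_append_left
    specialize ih h1
    rw [IsReducedWord, wordProd_append, List.length_append] at hl
    rw [IsReducedWord] at h1
    simp only [wordProd_cons, wordProd_nil, mul_one, List.length_singleton] at hl
    rw [wordProd_append]
    simp only [wordProd_cons, wordProd_nil, mul_one]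
    -- `T_{ws}` is `T_w` multiplied by `T_s` on the right, an operation commuting with both `h` and
    -- `h'`.
    rw [← heckeRightMul_single_of_lt (by omega)]
    have c := heckeAlgebra_comm_heckeRightMul b i h
    have c' := heckeAlgebra_comm_heckeRightMul b i h'
    rw [← Module.End.mul_apply, ← Module.End.mul_apply, c.eq, c'.eq, Module.End.mul_apply,
      Module.End.mul_apply, ih]

theorem heckeGen_prod_single {b : P.Base} {l : List b.support} (hl : IsReducedWord b l) :
    ((l.map (heckeGen b)).prod : Module.End Scalar (HeckeModule P)) (Finsupp.single 1 1) =
      Finsupp.single (wordProd b l) 1 := by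
  induction l with
  | nil => simp
  | cons i l ih =>
    have h := ih hl.of_cons
    rw [List.map_cons, List.prod_cons, MulMemClass.coe_mul, Module.End.mul_apply, h, wordProd_cons]
    exact heckeGenMul_single_of_lt hl.length_lt

/-- Both products take the same value at `T_1`; the braid relations for the `T_s` are the special
case of alternating words. -/
theorem heckeGen_prod_eq {b : P.Base} {l l' : List b.support} (hl : IsReducedWord b l)
    (hl' : IsReducedWord b l') (h : wordProd b l = wordProd b l') :
    (l.map (heckeGen b)).prod = (l'.map (heckeGen b)).prod :=
  heckeAlgebra_ext (by rw [heckeGen_prod_single hl, heckeGen_prod_single hl', h])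

theorem heckeGen_mul_self (b : P.Base) (i : b.support) :
    heckeGen b i * heckeGen b i = (q - 1 : Scalar) • heckeGen b i + (q : Scalar) • 1 := by
  apply Subtype.ext
  change heckeGenMul b i * heckeGenMul b i =
    (q - 1 : Scalar) • heckeGenMul b i + (q : Scalar) • (1 : Module.End Scalar (HeckeModule P))
  refine Finsupp.lhom_ext' fun w => LinearMap.ext_ring ?_
  simp only [LinearMap.comp_apply, Finsupp.lsingle_apply, Module.End.mul_apply,
    LinearMap.add_apply, LinearMap.smul_apply, Module.End.one_apply]
  rcases lt_or_gt_of_ne (length_simpleRefl_mul_ne b i w) with h | h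
  · have h' : length b (simpleRefl b i * w) < length b (simpleRefl b i * (simpleRefl b i * w)) := by
      simpa using h
    rw [heckeGenMul_single_of_gt h]
    simp only [map_add, map_smul]
    rw [heckeGenMul_single_of_gt h, heckeGenMul_single_of_lt h', simpleRefl_mul_cancel]
  · have h' : length b (simpleRefl b i * (simpleRefl b i * w)) < length b (simpleRefl b i * w) := by
      simpa using h
    rw [heckeGenMul_single_of_lt h, heckeGenMul_single_of_gt h', simpleRefl_mul_cancel]

/-! ### The invariant form and the twist by the long element -/

/-- The symmetric form with `⟨T_x, T_y⟩ = q_x δ_{x,y}`. -/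
noncomputable def heckeForm (b : P.Base) : LinearMap.BilinForm Scalar (HeckeModule P) :=
  LinearMap.mk₂ Scalar (fun f g => ∑ w, qpow b w * f w * g w)
    (by intros; simp [mul_add, add_mul, Finset.sum_add_distrib])
    (by intros; simp only [Finsupp.smul_apply, smul_eq_mul, Finset.mul_sum]
        exact Finset.sum_congr rfl fun _ _ => by ring)
    (by intros; simp [mul_add, Finset.sum_add_distrib])
    (by intros; simp only [Finsupp.smul_apply, smul_eq_mul, Finset.mul_sum]
        exact Finset.sum_congr rfl fun _ _ => by ring)

theorem heckeForm_apply (b : P.Base) (f g : HeckeModule P) :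
    heckeForm b f g = ∑ w, qpow b w * f w * g w := rfl

theorem heckeForm_single_left (b : P.Base) (x : P.weylGroup) (g : HeckeModule P) :
    heckeForm b (Finsupp.single x 1) g = qpow b x * g x := by
  rw [heckeForm_apply, Finset.sum_eq_single x]
  · simp
  · intro w _ h; simp [h.symm]
  · simp

theorem heckeForm_comm (b : P.Base) (f g : HeckeModule P) :
    heckeForm b f g = heckeForm b g f :=
  Finset.sum_congr rfl fun _ _ => by ring

/-- `T_s` links `T_x` and `T_{sx}` with coefficient `1` upwards and `q` downwards. The weights
satisfy `q_{sx} = q q_x` when `sx > x`, which makes the two contributions equal. -/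
theorem heckeForm_heckeGenMul (b : P.Base) (i : b.support) (f g : HeckeModule P) :
    heckeForm b (heckeGenMul b i f) g = heckeForm b f (heckeGenMul b i g) := by
  suffices h : heckeForm b ∘ₗ heckeGenMul b i = (heckeForm b).compl₂ (heckeGenMul b i) from
    LinearMap.congr_fun₂ h f g
  refine Finsupp.lhom_ext' fun x => LinearMap.ext_ring ?_
  refine Finsupp.lhom_ext' fun y => LinearMap.ext_ring ?_
  simp only [LinearMap.comp_apply, Finsupp.lsingle_apply, LinearMap.compl₂_apply]
  have key : ∀ x : P.weylGroup, length b x < length b (simpleRefl b i * x) →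
      qpow b (simpleRefl b i * x) = qpow b x * q := by
    intro x h
    rcases length_simpleRefl_mul b x i with h' | h'
    · rw [qpow, h'.1, pow_succ]; rfl
    · omega
  rw [heckeForm_comm b (heckeGenMul b i _), heckeForm_single_left, heckeForm_single_left]
  rcases lt_or_gt_of_ne (length_simpleRefl_mul_ne b i x) with hx | hx <;>
    rcases lt_or_gt_of_ne (length_simpleRefl_mul_ne b i y) with hy | hy
  · rw [heckeGenMul_single_of_gt hx, heckeGenMul_single_of_gt hy]
    by_cases e : x = y
    · subst e; rfl
    · have e1 : simpleRefl b i * x ≠ y := by rintro rfl; rw [simpleRefl_mul_cancel] at hy; omega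
      have e2 : simpleRefl b i * y ≠ x := by rintro rfl; rw [simpleRefl_mul_cancel] at hx; omega
      simp [e, e1, e2, Ne.symm e]
  · rw [heckeGenMul_single_of_gt hx, heckeGenMul_single_of_lt hy]
    have e : x ≠ y := by rintro rfl; omega
    by_cases e1 : simpleRefl b i * x = y
    · have := key y hy
      subst e1
      simp only [simpleRefl_mul_cancel] at this ⊢
      simp [e, this]
    · have e2 : simpleRefl b i * y ≠ x := by rintro rfl; simp at e1
      simp [e, e1, e2]
  · rw [heckeGenMul_single_of_lt hx, heckeGenMul_single_of_gt hy]
    have e : y ≠ x := by rintro rfl; omega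
    by_cases e1 : simpleRefl b i * x = y
    · subst e1
      simp only [simpleRefl_mul_cancel]
      simp [e, key x hx]
    · have e2 : simpleRefl b i * y ≠ x := by rintro rfl; simp at e1
      simp [e, e1, e2]
  · rw [heckeGenMul_single_of_lt hx, heckeGenMul_single_of_lt hy]
    have e1 : simpleRefl b i * x ≠ y := by rintro rfl; rw [simpleRefl_mul_cancel] at hy; omega
    have e2 : simpleRefl b i * y ≠ x := by rintro rfl; rw [simpleRefl_mul_cancel] at hx; omega
    simp [e1, e2]

theorem heckeForm_heckeGen_prod (b : P.Base) (l : List b.support) (f g : HeckeModule P) :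
    heckeForm b (((l.map (heckeGen b)).prod : Module.End Scalar (HeckeModule P)) f) g =
      heckeForm b f (((l.reverse.map (heckeGen b)).prod : Module.End Scalar (HeckeModule P)) g) := by
  induction l generalizing f g with
  | nil => simp
  | cons i l ih =>
    simp only [List.map_cons, List.prod_cons, MulMemClass.coe_mul, Module.End.mul_apply,
      List.reverse_cons, List.map_append, List.prod_append, List.map_nil, List.prod_nil, mul_one]
    rw [← ih]
    exact heckeForm_heckeGenMul b i _ _

/-- The linear map `T_u ↦ ε_{u w₀} q_{u w₀}⁻¹ T_{u w₀}`. -/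
noncomputable def longTwist (b : P.Base) : Module.End Scalar (HeckeModule P) :=
  Finsupp.linearCombination Scalar fun u : P.weylGroup =>
    (eps b (u * longElement b) * (qpow b (u * longElement b))⁻¹) •
      Finsupp.single (u * longElement b) (1 : Scalar)

theorem longTwist_single (b : P.Base) (u : P.weylGroup) :
    longTwist b (Finsupp.single u 1) =
      (eps b (u * longElement b) * (qpow b (u * longElement b))⁻¹) •
        Finsupp.single (u * longElement b) 1 := by
  rw [longTwist, Finsupp.linearCombination_single, one_smul]

theorem longTwist_aux_of_lt {F M : Type*} [Field F] [AddCommGroup M] [Module F M] {t Q ε : F}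
    (ht : t ≠ 0) (hQ : Q ≠ 0) (x y : M) :
    (-ε * Q⁻¹) • x = (t - 1) • (ε * (Q * t)⁻¹) • y - (ε * (Q * t)⁻¹) • ((t - 1) • y + t • x) := by
  match_scalars
  · field_simp
  · field_simp; ring

theorem longTwist_aux_of_gt {F M : Type*} [Field F] [AddCommGroup M] [Module F M] {t Q ε : F}
    (ht : t ≠ 0) (hQ : Q ≠ 0) (x y : M) :
    (t - 1) • (ε * Q⁻¹) • x + t • (-ε * (Q * t)⁻¹) • y =
      (t - 1) • (ε * Q⁻¹) • x - (ε * Q⁻¹) • y := by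
  match_scalars
  · field_simp
  · field_simp

/-- The map `u ↦ u w₀` exchanges the cases `su > u` and `su < u`. The operator `q - 1 - T_s` on the
right equals `-q T_s⁻¹`, and the factors `ε` and `q⁻¹` in the twist account for this sign and power
of `q`. -/
theorem longTwist_heckeGenMul (b : P.Base) (i : b.support) (f : HeckeModule P) :
    longTwist b (heckeGenMul b i f) =
      (q - 1) • longTwist b f - heckeGenMul b i (longTwist b f) := by
  suffices h : longTwist b ∘ₗ heckeGenMul b i =
      (q - 1) • longTwist b - heckeGenMul b i ∘ₗ longTwist b from LinearMap.congr_fun h f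
  refine Finsupp.lhom_ext' fun u => LinearMap.ext_ring ?_
  simp only [LinearMap.comp_apply, Finsupp.lsingle_apply, LinearMap.sub_apply,
    LinearMap.smul_apply]
  have hq := q_ne_zero
  have h1 := length_mul_longElement_add b u
  have h2 := length_mul_longElement_add b (simpleRefl b i * u)
  rw [mul_assoc] at h2
  have hne := qpow_ne_zero b (u * longElement b)
  rcases length_simpleRefl_mul b u i with h | h
  · have hu : length b u < length b (simpleRefl b i * u) := by omega
    have hw : length b (simpleRefl b i * (u * longElement b)) < length b (u * longElement b) := by
      omega
    have hlen : length b (u * longElement b) =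
      length b (simpleRefl b i * (u * longElement b)) + 1 := by omega
    rw [heckeGenMul_single_of_lt hu, longTwist_single, longTwist_single, map_smul,
      heckeGenMul_single_of_gt hw, mul_assoc, eps_simpleRefl_mul]
    have hqq : qpow b (u * longElement b) = qpow b (simpleRefl b i * (u * longElement b)) * q := by
      rw [qpow, hlen, pow_succ]; rfl
    have hne' := qpow_ne_zero b (simpleRefl b i * (u * longElement b))
    rw [hqq]
    exact longTwist_aux_of_lt q_ne_zero hne' _ _
  · have hu : length b (simpleRefl b i * u) < length b u := by omega
    have hw : length b (u * longElement b) < length b (simpleRefl b i * (u * longElement b)) := by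
      omega
    have hlen : length b (simpleRefl b i * (u * longElement b)) =
      length b (u * longElement b) + 1 := by omega
    rw [heckeGenMul_single_of_gt hu, map_add, map_smul, map_smul, longTwist_single,
      longTwist_single, map_smul, heckeGenMul_single_of_lt hw, mul_assoc, eps_simpleRefl_mul]
    have hqq : qpow b (simpleRefl b i * (u * longElement b)) = qpow b (u * longElement b) * q := by
      rw [qpow, hlen, pow_succ]; rfl
    rw [hqq]
    exact longTwist_aux_of_gt q_ne_zero hne _ _

theorem longTwist_apply (b : P.Base) (f : HeckeModule P) (w : P.weylGroup) :
    longTwist b f w = eps b w * (qpow b w)⁻¹ * f (w * longElement b) := by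
  suffices h : Finsupp.lapply w ∘ₗ longTwist b =
      (eps b w * (qpow b w)⁻¹) • Finsupp.lapply (w * longElement b) from LinearMap.congr_fun h f
  refine Finsupp.lhom_ext' fun u => LinearMap.ext_ring ?_
  simp only [LinearMap.comp_apply, Finsupp.lsingle_apply, longTwist_single, LinearMap.smul_apply,
    Finsupp.lapply_apply, Finsupp.smul_apply, Finsupp.single_apply, smul_eq_mul]
  have : u * longElement b = w ↔ u = w * longElement b := by
    rw [← mul_inv_eq_iff_eq_mul, longElement_inv]
  by_cases h : u * longElement b = w
  · rw [if_pos h, if_pos (this.mp h), h]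
  · rw [if_neg h, if_neg (fun e => h (this.mpr e)), mul_zero, mul_zero]

/-- The weight `q_w` of the form cancels the one in the twist, leaving the signed pairing of the
coordinates `w` and `w w₀` that produces the sums of the theorem. -/
theorem heckeForm_longTwist (b : P.Base) (f g : HeckeModule P) :
    heckeForm b f (longTwist b g) = ∑ w, eps b w * f w * g (w * longElement b) := by
  rw [heckeForm_apply]
  refine Finset.sum_congr rfl fun w _ => ?_
  rw [longTwist_apply]
  have := qpow_ne_zero b w
  field_simp

/-! ### Yang–Baxter identities in types A₁ × A₁, A₂, B₂ and G₂ -/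

section YangBaxter

variable {F A : Type*} [Field F] [Semiring A] [Algebra F A]

/-- The factor `S + (t - 1) a / (1 - a)` of a Yang–Baxter product. -/
def ybFactor (t : F) (S : A) (a : F) : A := S + ((t - 1) * (a / (1 - a))) • (1 : A)

/-- Only the quadratic relation of `S` enters, so the same expansion serves for triples inside the
longer products, with the roles of `S` and `T` exchanged when needed. -/
theorem ybFactor_three {t c₁ c₂ c₃ : F} {S T : A} (hS : S * S = (t - 1) • S + t • 1) :
    (S + c₁ • 1) * ((T + c₂ • 1) * (S + c₃ • 1)) =
      S * (T * S) + c₁ • (T * S) + c₃ • (S * T) + (c₁ * c₃) • T +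
        (c₂ * (t - 1) + c₁ * c₂ + c₂ * c₃) • S + (c₁ * c₂ * c₃ + c₂ * t) • (1 : A) := by
  simp only [mul_add, add_mul, smul_mul_assoc, mul_smul_comm, mul_one, one_mul, hS, smul_add,
    smul_smul]
  module

theorem yangBaxter_two {t a b : F} {S T : A} (h : S * T = T * S) :
    ybFactor t S a * ybFactor t T b = ybFactor t T b * ybFactor t S a := by
  simp only [ybFactor, mul_add, add_mul, smul_mul_assoc, mul_smul_comm, mul_one, one_mul, h]
  module

/-- Type A₂. With `a` and `b` the values of `z` at the two simple roots, the parameters are its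
values at all positive roots, in the order of one reduced word on the left and in the reverse order
on the right. Types B₂ and G₂ below follow the same pattern, with `a` at the short simple root. -/
theorem yangBaxter_three {t a b : F} {S T : A} (hS : S * S = (t - 1) • S + t • 1)
    (hT : T * T = (t - 1) • T + t • 1) (h : S * (T * S) = T * (S * T))
    (ha : a ≠ 1) (hb : b ≠ 1) (hab : a * b ≠ 1) :
    ybFactor t S a * (ybFactor t T (a * b) * ybFactor t S b) =
      ybFactor t T b * (ybFactor t S (a * b) * ybFactor t T a) := by
  replace ha : 1 - a ≠ 0 := sub_ne_zero.mpr ha.symm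
  replace hb : 1 - b ≠ 0 := sub_ne_zero.mpr hb.symm
  replace hab : 1 - a * b ≠ 0 := sub_ne_zero.mpr hab.symm
  simp only [ybFactor]
  rw [ybFactor_three hS, ybFactor_three hT, h]
  match_scalars <;> field_simp <;> ring

theorem yangBaxter_four {t a b : F} {S T : A} (hS : S * S = (t - 1) • S + t • 1)
    (hT : T * T = (t - 1) • T + t • 1) (h : S * (T * (S * T)) = T * (S * (T * S)))
    (ha : a ≠ 1) (hb : b ≠ 1) (hab : a * b ≠ 1) (haab : a ^ 2 * b ≠ 1) :
    ybFactor t S a * (ybFactor t T (a ^ 2 * b) * (ybFactor t S (a * b) * ybFactor t T b)) =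
      ybFactor t T b * (ybFactor t S (a * b) * (ybFactor t T (a ^ 2 * b) * ybFactor t S a)) := by
  replace ha : 1 - a ≠ 0 := sub_ne_zero.mpr ha.symm
  replace hb : 1 - b ≠ 0 := sub_ne_zero.mpr hb.symm
  replace hab : 1 - a * b ≠ 0 := sub_ne_zero.mpr hab.symm
  replace haab : 1 - a ^ 2 * b ≠ 0 := sub_ne_zero.mpr haab.symm
  have hab' : 1 - b * a ≠ 0 := mul_comm a b ▸ hab
  have haab' : 1 - b * a ^ 2 ≠ 0 := mul_comm (a ^ 2) b ▸ haab
  have hS' : ∀ x, S * (S * x) = (t - 1) • (S * x) + t • x := fun x => by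
    rw [← mul_assoc, hS]; simp [add_mul]
  have hT' : ∀ x, T * (T * x) = (t - 1) • (T * x) + t • x := fun x => by
    rw [← mul_assoc, hT]; simp [add_mul]
  simp only [ybFactor]
  rw [ybFactor_three (S := T) hT, ybFactor_three hS]
  simp only [mul_add, add_mul, smul_mul_assoc, mul_smul_comm, mul_one, one_mul, hS, hT, hS', hT',
    smul_add, smul_smul, h]
  match_scalars <;> field_simp <;> ring

set_option maxHeartbeats 2000000 in
theorem yangBaxter_six {t a b : F} {S T : A} (hS : S * S = (t - 1) • S + t • 1)
    (hT : T * T = (t - 1) • T + t • 1)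
    (h : S * (T * (S * (T * (S * T)))) = T * (S * (T * (S * (T * S)))))
    (ha : a ≠ 1) (hb : b ≠ 1) (h11 : a * b ≠ 1) (h21 : a ^ 2 * b ≠ 1) (h31 : a ^ 3 * b ≠ 1)
    (h32 : a ^ 3 * b ^ 2 ≠ 1) :
    ybFactor t S a * (ybFactor t T (a ^ 3 * b) * (ybFactor t S (a ^ 2 * b) *
      (ybFactor t T (a ^ 3 * b ^ 2) * (ybFactor t S (a * b) * ybFactor t T b)))) =
      ybFactor t T b * (ybFactor t S (a * b) * (ybFactor t T (a ^ 3 * b ^ 2) *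
        (ybFactor t S (a ^ 2 * b) * (ybFactor t T (a ^ 3 * b) * ybFactor t S a)))) := by
  replace ha : 1 - a ≠ 0 := sub_ne_zero.mpr ha.symm
  replace hb : 1 - b ≠ 0 := sub_ne_zero.mpr hb.symm
  replace h11 : 1 - a * b ≠ 0 := sub_ne_zero.mpr h11.symm
  replace h21 : 1 - a ^ 2 * b ≠ 0 := sub_ne_zero.mpr h21.symm
  replace h31 : 1 - a ^ 3 * b ≠ 0 := sub_ne_zero.mpr h31.symm
  replace h32 : 1 - a ^ 3 * b ^ 2 ≠ 0 := sub_ne_zero.mpr h32.symm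
  have h11' : 1 - b * a ≠ 0 := mul_comm a b ▸ h11
  have h21' : 1 - b * a ^ 2 ≠ 0 := mul_comm (a ^ 2) b ▸ h21
  have h31' : 1 - b * a ^ 3 ≠ 0 := mul_comm (a ^ 3) b ▸ h31
  have h32' : 1 - b ^ 2 * a ^ 3 ≠ 0 := mul_comm (a ^ 3) (b ^ 2) ▸ h32
  have hS' : ∀ x, S * (S * x) = (t - 1) • (S * x) + t • x := fun x => by
    rw [← mul_assoc, hS]; simp [add_mul]
  have hT' : ∀ x, T * (T * x) = (t - 1) • (T * x) + t • x := fun x => by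
    rw [← mul_assoc, hT]; simp [add_mul]
  -- Regroups the six factors as a product of two triples, to which `ybFactor_three` applies.
  have h3 : ∀ x y z u : A, x * (y * (z * u)) = (x * (y * z)) * u := fun x y z u => by
    simp only [mul_assoc]
  rw [h3 (ybFactor t S a), h3 (ybFactor t T b)]
  simp only [ybFactor]
  rw [ybFactor_three hS, ybFactor_three hT, ybFactor_three hS, ybFactor_three hT]
  simp only [mul_add, add_mul, smul_mul_assoc, mul_smul_comm, mul_one, one_mul, mul_assoc,
    hS, hT, hS', hT', smul_add, smul_smul, h]
  match_scalars <;> field_simp <;> ring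

end YangBaxter

/-! ### The Weyl group action on the torus -/

theorem charVal_add (z : Torus X) (x y : X) : charVal z (x + y) = charVal z x * charVal z y := by
  simp [charVal, ofAdd_add]

theorem charVal_nsmul (z : Torus X) (n : ℕ) (x : X) : charVal z (n • x) = charVal z x ^ n := by
  simp [charVal, ofAdd_nsmul]

theorem charVal_neg (z : Torus X) (x : X) : charVal z (-x) = (charVal z x)⁻¹ := by
  simp [charVal, ofAdd_neg]

theorem charVal_ne_zero (z : Torus X) (x : X) : charVal z x ≠ 0 := Units.ne_zero _

theorem charVal_inv (z : Torus X) (x : X) : charVal z⁻¹ x = (charVal z x)⁻¹ := by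
  simp [charVal]

theorem charVal_torusAct (w : P.weylGroup) (z : Torus X) (x : X) :
    charVal (torusAct w z) x = charVal z (w⁻¹ • x) := rfl

theorem torusAct_ext {z z' : Torus X} (h : ∀ x, charVal z x = charVal z' x) : z = z' :=
  MonoidHom.ext fun x => Units.ext (h x)

theorem torusAct_one (z : Torus X) : torusAct (1 : P.weylGroup) z = z :=
  torusAct_ext fun x => by rw [charVal_torusAct, inv_one, one_smul]

theorem torusAct_mul (w w' : P.weylGroup) (z : Torus X) :
    torusAct (w * w') z = torusAct w (torusAct w' z) :=
  torusAct_ext fun x => by simp only [charVal_torusAct, mul_inv_rev, mul_smul]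

theorem torusAct_inv (w : P.weylGroup) (z : Torus X) : torusAct w z⁻¹ = (torusAct w z)⁻¹ :=
  torusAct_ext fun x => by simp only [charVal_torusAct, charVal_inv]

theorem charVal_torusAct_root (w : P.weylGroup) (z : Torus X) (i : ι) :
    charVal (torusAct w z) (P.root i) = charVal z (P.root (P.weylGroupToPerm w⁻¹ i)) := by
  rw [charVal_torusAct, weylGroup_apply_root]

theorem IsRegular.torusAct {z : Torus X} (hz : IsRegular P z) (w : P.weylGroup) :
    IsRegular P (torusAct w z) := fun i => by
  rw [charVal_torusAct_root]; exact hz _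

theorem IsRegular.inv {z : Torus X} (hz : IsRegular P z) : IsRegular P z⁻¹ := fun i => by
  rw [charVal_inv]; exact inv_ne_one.mpr (hz i)

theorem charVal_torusAct_simpleRefl (b : P.Base) (i : b.support) (z : Torus X) :
    charVal (torusAct (simpleRefl b i) z) (P.root i) = (charVal z (P.root i))⁻¹ := by
  rw [charVal_torusAct, simpleRefl_inv, ← charVal_neg]
  congr 1
  exact P.reflection_apply_self i

/-! ### Products of the elements `μ` along words -/

theorem longTwist_muSimple_aux {F M : Type*} [Field F] [AddCommGroup M] [Module F M] {t : F}
    (ht : t ≠ 0) (c : F) (x y : M) :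
    t⁻¹ • ((t - 1) • x - y) + ((1 - t⁻¹) * c) • x =
      -(t⁻¹ • y + ((1 - t⁻¹) * (-1 - c)) • x) := by
  match_scalars
  · field_simp; ring
  · ring

theorem muSimple_eq (b : P.Base) (z : Torus X) (i : b.support) :
    muSimple b z i =
      (q⁻¹ : Scalar) • ybFactor q (heckeGen b i) (RatFunc.C (charVal z (P.root i))) := by
  rw [muSimple, ybFactor, smul_add, smul_smul, Algebra.algebraMap_eq_smul_one, map_div₀, map_sub,
    map_one, ← mul_assoc, mul_sub, inv_mul_cancel₀ q_ne_zero, mul_one]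

theorem muSimple_congr {b : P.Base} {z z' : Torus X} {i : b.support}
    (h : charVal z (P.root i) = charVal z' (P.root i)) : muSimple b z i = muSimple b z' i := by
  rw [muSimple, muSimple, h]

@[simp] theorem muWord_nil (b : P.Base) (z : Torus X) : muWord b z [] = 1 := rfl

theorem muWord_cons (b : P.Base) (z : Torus X) (i : b.support) (l : List b.support) :
    muWord b z (i :: l) = muWord b z l * muSimple b (torusAct (wordProd b l) z) i := rfl

theorem muWord_append (b : P.Base) (z : Torus X) (l l' : List b.support) :
    muWord b z (l ++ l') = muWord b z l' * muWord b (torusAct (wordProd b l') z) l := by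
  induction l with
  | nil => simp
  | cons i l ih =>
    rw [List.cons_append, muWord_cons, ih, muWord_cons, wordProd_append, torusAct_mul, mul_assoc]

theorem muWord_singleton (b : P.Base) (z : Torus X) (i : b.support) :
    muWord b z [i] = muSimple b z i := by
  rw [muWord_cons, muWord_nil, one_mul, wordProd_nil, torusAct_one]

/-- The scalar terms for `a` and `a⁻¹` add up to `-(t - 1)`, which cancels the linear term of `S²`.
-/
theorem ybFactor_mul_ybFactor_inv {F A : Type*} [Field F] [Semiring A] [Algebra F A] {t a : F} {S : A}
    (hS : S * S = (t - 1) • S + t • 1) (ha0 : a ≠ 0) (ha : a ≠ 1) :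
    ybFactor t S a * ybFactor t S a⁻¹ =
      (t + (t - 1) * (a / (1 - a)) * ((t - 1) * (a⁻¹ / (1 - a⁻¹)))) • (1 : A) := by
  have h1 : 1 - a ≠ 0 := sub_ne_zero.mpr ha.symm
  have h2 : a⁻¹ / (1 - a⁻¹) = -1 - a / (1 - a) := by
    have h3 : a - 1 ≠ 0 := sub_ne_zero.mpr ha
    have : a⁻¹ / (1 - a⁻¹) = 1 / (a - 1) := by field_simp
    rw [this]; field_simp; ring
  rw [ybFactor, ybFactor, h2]
  simp only [mul_add, add_mul, smul_mul_assoc, mul_smul_comm, mul_one, one_mul, hS]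
  module

theorem C_ne_one {a : ℂ} (ha : a ≠ 1) : (RatFunc.C a : Scalar) ≠ 1 := by
  rw [← map_one RatFunc.C]; exact fun h => ha (RatFunc.C_injective h)

theorem C_ne_zero {a : ℂ} (ha : a ≠ 0) : (RatFunc.C a : Scalar) ≠ 0 := by
  rw [← map_zero RatFunc.C]; exact fun h => ha (RatFunc.C_injective h)

/-- The product of the two intertwining factors attached to `s` and `s` is a scalar. -/
theorem exists_muSimple_mul_muSimple (b : P.Base) {z : Torus X} (hz : IsRegular P z)
    (i : b.support) : ∃ κ : Scalar,
      muSimple b z i * muSimple b (torusAct (simpleRefl b i) z) i = κ • 1 := by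
  rw [muSimple_eq, muSimple_eq, charVal_torusAct_simpleRefl, map_inv₀, smul_mul_smul_comm,
    ybFactor_mul_ybFactor_inv (heckeGen_mul_self b i) (C_ne_zero (charVal_ne_zero _ _))
      (C_ne_one (hz _)), smul_smul]
  exact ⟨_, rfl⟩

theorem heckeForm_muSimple (b : P.Base) (z : Torus X) (i : b.support) (f g : HeckeModule P) :
    heckeForm b ((muSimple b z i : Module.End Scalar (HeckeModule P)) f) g =
      heckeForm b f ((muSimple b z i : Module.End Scalar (HeckeModule P)) g) := by
  simp only [muSimple, heckeGen, Algebra.algebraMap_eq_smul_one, Subalgebra.coe_add,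
    Subalgebra.coe_smul, Subalgebra.coe_one, LinearMap.add_apply, LinearMap.smul_apply,
    Module.End.one_apply, map_add, map_smul, heckeForm_heckeGenMul]

/-- Each factor is self-adjoint, so the adjoint is the product in reverse order. Started at
`(wz)⁻¹`, the reversed word meets the same parameters, because `s` inverts the value at its own root
and the inversion of the point inverts it again. -/
theorem heckeForm_muWord (b : P.Base) (z : Torus X) (l : List b.support) (f g : HeckeModule P) :
    heckeForm b ((muWord b z l : Module.End Scalar (HeckeModule P)) f) g =
      heckeForm b f ((muWord b (torusAct (wordProd b l) z⁻¹) l.reverse :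
        Module.End Scalar (HeckeModule P)) g) := by
  induction l generalizing f g with
  | nil => simp
  | cons i l ih =>
    rw [muWord_cons, MulMemClass.coe_mul, Module.End.mul_apply, ih, heckeForm_muSimple,
      List.reverse_cons, muWord_append, muWord_singleton, MulMemClass.coe_mul, Module.End.mul_apply]
    have h1 : torusAct (wordProd b [i]) (torusAct (wordProd b (i :: l)) z⁻¹) =
        torusAct (wordProd b l) z⁻¹ := by
      rw [← torusAct_mul]; simp
    have h2 : muSimple b (torusAct (wordProd b l) z) i =
        muSimple b (torusAct (wordProd b (i :: l)) z⁻¹) i := by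
      apply muSimple_congr
      rw [wordProd_cons, torusAct_mul, charVal_torusAct_simpleRefl, torusAct_inv, charVal_inv,
        inv_inv]
    rw [h1, h2]

/-- With `c = z^α/(1-z^α)`, replacing `T_s` by `q - 1 - T_s` negates the factor and changes `c` to
`-1 - c`, the value belonging to `z⁻¹`. -/
theorem longTwist_muSimple (b : P.Base) {z : Torus X} (hz : IsRegular P z) (i : b.support)
    (f : HeckeModule P) :
    longTwist b ((muSimple b z i : Module.End Scalar (HeckeModule P)) f) =
      -(muSimple b z⁻¹ i : Module.End Scalar (HeckeModule P)) (longTwist b f) := by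
  simp only [muSimple, heckeGen, Algebra.algebraMap_eq_smul_one, Subalgebra.coe_add,
    Subalgebra.coe_smul, Subalgebra.coe_one, LinearMap.add_apply, LinearMap.smul_apply,
    Module.End.one_apply, map_add, map_smul, longTwist_heckeGenMul, charVal_inv]
  have h0 := charVal_ne_zero z (P.root i)
  have h1 : 1 - charVal z (P.root i) ≠ 0 := sub_ne_zero.mpr (hz i).symm
  have hc : (charVal z (P.root i))⁻¹ / (1 - (charVal z (P.root i))⁻¹) =
      -1 - charVal z (P.root i) / (1 - charVal z (P.root i)) := by
    have h3 : charVal z (P.root i) - 1 ≠ 0 := sub_ne_zero.mpr (hz i)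
    have : (charVal z (P.root i))⁻¹ / (1 - (charVal z (P.root i))⁻¹) =
      1 / (charVal z (P.root i) - 1) := by field_simp
    rw [this]; field_simp; ring
  rw [hc, map_sub, map_neg, map_one]
  exact longTwist_muSimple_aux q_ne_zero _ _ _

theorem longTwist_muWord (b : P.Base) {z : Torus X} (hz : IsRegular P z) (l : List b.support)
    (f : HeckeModule P) :
    longTwist b ((muWord b z l : Module.End Scalar (HeckeModule P)) f) =
      (-1 : Scalar) ^ l.length •
        (muWord b z⁻¹ l : Module.End Scalar (HeckeModule P)) (longTwist b f) := by
  induction l generalizing f with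
  | nil => simp
  | cons i l ih =>
    rw [muWord_cons, muWord_cons, MulMemClass.coe_mul, MulMemClass.coe_mul, Module.End.mul_apply,
      Module.End.mul_apply, ih, longTwist_muSimple b (hz.torusAct _), torusAct_inv, map_neg,
      List.length_cons, pow_succ, mul_neg_one, neg_smul, smul_neg]

/-! ### Support of `μ_z(w)` -/

theorem heckeRightMul_apply (b : P.Base) (i : b.support) (f : HeckeModule P) (y : P.weylGroup) :
    heckeRightMul b i f y = if length b (y * simpleRefl b i) < length b y then
      f (y * simpleRefl b i) + (q - 1) * f y else q * f (y * simpleRefl b i) := by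
  have ne : ∀ w, length b (w * simpleRefl b i) ≠ length b w := fun w => by
    rcases length_mul_simpleRefl b w i with h | h <;> omega
  have hxy : ∀ x, x * simpleRefl b i = y ↔ x = y * simpleRefl b i := fun x => by
    rw [← mul_inv_eq_iff_eq_mul, simpleRefl_inv]
  induction f using Finsupp.induction_linear with
  | zero => simp
  | add f g hf hg =>
    rw [map_add, Finsupp.add_apply, hf, hg]
    simp only [Finsupp.add_apply]
    split_ifs <;> ring
  | single x c =>
    have hc : Finsupp.single x c = c • Finsupp.single x (1 : Scalar) := by simp
    rw [hc, map_smul]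
    rcases lt_or_gt_of_ne (ne x) with hx | hx
    · rw [heckeRightMul_single_of_gt hx]
      simp only [Finsupp.smul_apply, Finsupp.add_apply, Finsupp.single_apply, smul_eq_mul, hxy]
      by_cases h1 : x = y
      · subst h1
        have : x ≠ x * simpleRefl b i := fun h => ne x (congrArg (length b) h.symm)
        simp [hx, this]; ring
      · by_cases h2 : x = y * simpleRefl b i
        · subst h2
          rw [mul_simpleRefl_cancel] at hx
          rw [if_neg hx.not_gt]; simp [h1]; ring
        · simp [h1, h2]
    · rw [heckeRightMul_single_of_lt hx]
      simp only [Finsupp.smul_apply, Finsupp.single_apply, smul_eq_mul, hxy]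
      by_cases h2 : x = y * simpleRefl b i
      · subst h2
        rw [mul_simpleRefl_cancel] at hx
        have h1 : y * simpleRefl b i ≠ y := fun h => ne y (congrArg (length b) h)
        simp [hx, h1]
      · by_cases h1 : x = y
        · subst h1
          simp [hx.not_gt, h2]
        · simp [h1, h2]

/-- The coefficient vector of `μ_z` of a word. -/
noncomputable def muVec (b : P.Base) (z : Torus X) (l : List b.support) : HeckeModule P :=
  (muWord b z l : Module.End Scalar (HeckeModule P)) (Finsupp.single 1 1)

/-- The new factor stands on the right of the product. On `T_1`, left and right multiplication by
`T_s` agree, and right multiplication then passes through the rest of the product. -/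
theorem muVec_cons (b : P.Base) (z : Torus X) (i : b.support) (l : List b.support) :
    ∃ c : Scalar, muVec b z (i :: l) =
      (q⁻¹ : Scalar) • heckeRightMul b i (muVec b z l) + c • muVec b z l := by
  refine ⟨(1 - q⁻¹) * RatFunc.C (charVal (torusAct (wordProd b l) z) (P.root i) /
    (1 - charVal (torusAct (wordProd b l) z) (P.root i))), ?_⟩
  have h1 : heckeRightMul b i (Finsupp.single 1 1) = heckeGenMul b i (Finsupp.single 1 1) := by
    have h := (length_simpleRefl_mul_ne b i 1)
    rw [mul_one, length_one] at h
    rw [heckeRightMul_single_of_lt (by rw [one_mul, length_one]; omega),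
      heckeGenMul_single_of_lt (by rw [mul_one, length_one]; omega), one_mul, mul_one]
  rw [muVec, muWord_cons, muVec, ← Module.End.mul_apply (heckeRightMul b i),
    ← (heckeAlgebra_comm_heckeRightMul b i (muWord b z l)).eq, Module.End.mul_apply, h1]
  simp only [muSimple, heckeGen, Algebra.algebraMap_eq_smul_one, Subalgebra.coe_add,
    Subalgebra.coe_smul, Subalgebra.coe_one, LinearMap.add_apply, LinearMap.smul_apply,
    Module.End.one_apply, map_add, map_smul, MulMemClass.coe_mul, Module.End.mul_apply]

/-- A nonzero coefficient at `u⁻¹` comes from one at `u⁻¹` or at `u⁻¹s = (su)⁻¹` for the shorter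
word. Both cases stay below the longer product by the lifting property. -/
theorem bruhatLE_of_muVec_ne_zero (b : P.Base) (z : Torus X) {l : List b.support}
    (hl : IsReducedWord b l) (u : P.weylGroup) (h : muVec b z l u⁻¹ ≠ 0) :
    bruhatLE b u (wordProd b l) := by
  induction l generalizing u with
  | nil =>
    have : u = 1 := by
      by_contra hu
      apply h
      have : (1 : P.weylGroup) ≠ u⁻¹ := fun e => hu (inv_eq_one.mp e.symm)
      simp [muVec, this]
    subst this; exact bruhatLE_refl _ _
  | cons i l ih =>
    have hlt := hl.length_lt
    rw [wordProd_cons]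
    by_cases h1 : muVec b z l u⁻¹ = 0
    · have h2 : muVec b z l (u⁻¹ * simpleRefl b i) ≠ 0 := by
        intro h2
        apply h
        obtain ⟨c, e⟩ := muVec_cons b z i l
        rw [e, Finsupp.add_apply, Finsupp.smul_apply, heckeRightMul_apply, Finsupp.smul_apply, h1,
          h2]
        simp
      have h3 := ih hl.of_cons (simpleRefl b i * u) (by simpa using h2)
      simpa using simpleRefl_mul_bruhatLE_simpleRefl_mul hlt h3
    · exact bruhatLE_trans (ih hl.of_cons u h1) (bruhatLE_simpleRefl_mul hlt)

/-- Only the choice of `q⁻¹ T_s` in every factor reaches the top element. -/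
theorem muVec_wordProd_inv (b : P.Base) (z : Torus X) {l : List b.support}
    (hl : IsReducedWord b l) : muVec b z l (wordProd b l)⁻¹ = (q⁻¹ : Scalar) ^ l.length := by
  induction l with
  | nil => simp [muVec]
  | cons i l ih =>
    have hlt := hl.length_lt
    obtain ⟨c, e⟩ := muVec_cons b z i l
    -- The new top element is longer than everything in the support of the shorter product.
    have h0 : muVec b z l (simpleRefl b i * wordProd b l)⁻¹ = 0 := by
      by_contra h
      rcases eq_or_length_lt_of_bruhatLE (bruhatLE_of_muVec_ne_zero b z hl.of_cons _ h) with h | h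
      · rw [h] at hlt; omega
      · omega
    rw [e, wordProd_cons, Finsupp.add_apply, Finsupp.smul_apply, heckeRightMul_apply,
      Finsupp.smul_apply, h0]
    have h1 : (simpleRefl b i * wordProd b l)⁻¹ * simpleRefl b i = (wordProd b l)⁻¹ := by simp
    rw [h1, length_inv, length_inv, if_pos hlt, ih hl.of_cons, List.length_cons, pow_succ]
    simp [mul_comm]

/-! ### Braid relations for the elements `μ` -/

/-- The alternating word `i j i j ⋯` of length `n`. -/
def altWord {α : Type*} : α → α → ℕ → List α
  | _, _, 0 => []
  | i, j, n + 1 => i :: altWord j i n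

@[simp] theorem length_altWord {α : Type*} (i j : α) (n : ℕ) : (altWord i j n).length = n := by
  induction n generalizing i j with
  | zero => rfl
  | succ n ih => simp [altWord, ih]

/-- The two alternating words of length `m` in `i` and `j` are reduced words for the same
element. -/
structure IsBraidPair (b : P.Base) (i j : b.support) (m : ℕ) : Prop where
  prod_eq : wordProd b (altWord i j m) = wordProd b (altWord j i m)
  pos_left : ∀ n < m, b.IsPos (P.weylGroupToPerm (wordProd b (altWord i j n))⁻¹ j)
  pos_right : ∀ n < m, b.IsPos (P.weylGroupToPerm (wordProd b (altWord j i n))⁻¹ i)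

theorem IsBraidPair.symm {b : P.Base} {i j : b.support} {m : ℕ} (h : IsBraidPair b i j m) :
    IsBraidPair b j i m := ⟨h.prod_eq.symm, h.pos_right, h.pos_left⟩

theorem IsBraidPair.isReducedWord {b : P.Base} {i j : b.support} {m : ℕ}
    (h : IsBraidPair b i j m) : IsReducedWord b (altWord i j m) := by
  have key : ∀ n, ∀ i j, IsBraidPair b i j m → n ≤ m → IsReducedWord b (altWord i j n) := by
    intro n
    induction n with
    | zero => intro i j _ _; simp [IsReducedWord, altWord]
    | succ n ih =>
      intro i j h hn
      exact (ih j i h.symm (by omega)).cons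
        ((length_lt_simpleRefl_mul_iff b _ i).mpr (h.pos_right n (by omega)))
  exact key m i j h le_rfl

theorem IsBraidPair.heckeGen_prod_eq {b : P.Base} {i j : b.support} {m : ℕ}
    (h : IsBraidPair b i j m) :
    ((altWord i j m).map (heckeGen b)).prod = ((altWord j i m).map (heckeGen b)).prod :=
  CasselmanBasis.heckeGen_prod_eq h.isReducedWord h.symm.isReducedWord h.prod_eq

theorem eq_of_smul_eq {w w' : P.weylGroup} (h : ∀ x : X, w • x = w' • x) : w = w' := by
  apply Subtype.ext
  apply Equiv.weightHom_injective P
  ext x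
  exact h x

theorem simpleRefl_smul (b : P.Base) (i : b.support) (x : X) :
    simpleRefl b i • x = x - P.coroot' i x • P.root i := P.reflection_apply i x

/-- Rewriting rule for coordinates in the plane of two simple roots; the pairing is written `-k` so
that the coefficients of positive roots come out as natural numbers. -/
theorem simpleRefl_smul_left {b : P.Base} {i j : b.support} {k : ℤ} (h : P.pairing j i = -k)
    (m n : ℤ) : simpleRefl b i • (m • P.root i + n • P.root j) =
      (k * n - m) • P.root i + n • P.root j := by
  rw [simpleRefl_smul, map_add, map_zsmul, map_zsmul, root_coroot'_eq_pairing,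
    root_coroot'_eq_pairing, h, pairing_same]
  simp only [smul_eq_mul]
  module

theorem simpleRefl_smul_right {b : P.Base} {i j : b.support} {k : ℤ} (h : P.pairing i j = -k)
    (m n : ℤ) : simpleRefl b j • (m • P.root i + n • P.root j) =
      m • P.root i + (k * m - n) • P.root j := by
  rw [add_comm, simpleRefl_smul_left h, add_comm]

theorem isPos_of_root_eq {b : P.Base} {i j : b.support} {l : ι} {m n : ℤ}
    (h : P.root l = m • P.root i + n • P.root j) (hm : 0 ≤ m) (hn : 0 ≤ n) : b.IsPos l := by
  classical
  have hs : P.root l = ∑ s ∈ b.support,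
      ((Pi.single (i : ι) m + Pi.single (j : ι) n : ι → ℤ)) s • P.root s := by
    simp [h, add_smul, Finset.sum_add_distrib, Pi.single_apply, ite_smul]
  rw [Base.isPos_iff', Base.height_eq_sum hs]
  refine Finset.sum_nonneg fun s _ => ?_
  simp only [Pi.add_apply, Pi.single_apply]
  split_ifs <;> omega

theorem charVal_comb (z : Torus X) (x y : X) (m n : ℕ) :
    charVal z ((m : ℤ) • x + (n : ℤ) • y) = charVal z x ^ m * charVal z y ^ n := by
  rw [charVal_add, natCast_zsmul, natCast_zsmul, charVal_nsmul, charVal_nsmul]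

theorem muSimple_torusAct_eq {b : P.Base} {z : Torus X} (hz : IsRegular P z) {i j s : b.support}
    {l : List b.support} (m n : ℕ)
    (h : (wordProd b l)⁻¹ • P.root s = (m : ℤ) • P.root i + (n : ℤ) • P.root j) :
    muSimple b (torusAct (wordProd b l) z) s = (q⁻¹ : Scalar) • ybFactor q (heckeGen b s)
      (RatFunc.C (charVal z (P.root i)) ^ m * RatFunc.C (charVal z (P.root j)) ^ n) ∧
    (RatFunc.C (charVal z (P.root i)) ^ m * RatFunc.C (charVal z (P.root j)) ^ n : Scalar) ≠ 1 := by
  have e : charVal (torusAct (wordProd b l) z) (P.root s) =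
      charVal z (P.root i) ^ m * charVal z (P.root j) ^ n := by
    rw [charVal_torusAct, h, charVal_comb]
  rw [muSimple_eq, e, map_mul, map_pow, map_pow]
  refine ⟨rfl, ?_⟩
  rw [← map_pow, ← map_pow, ← map_mul, ← e]
  exact C_ne_one (hz.torusAct _ _)

theorem isPos_perm_right {b : P.Base} {i j : b.support} {w : P.weylGroup} {m n : ℤ}
    (h : w⁻¹ • ((0 : ℤ) • P.root i + (1 : ℤ) • P.root j) = m • P.root i + n • P.root j)
    (hm : 0 ≤ m) (hn : 0 ≤ n) : b.IsPos (P.weylGroupToPerm w⁻¹ j) := by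
  refine isPos_of_root_eq (b := b) (i := i) (j := j) ?_ hm hn
  rw [← weylGroup_apply_root, ← h, zero_smul, zero_add, one_smul]

theorem isPos_perm_left {b : P.Base} {i j : b.support} {w : P.weylGroup} {m n : ℤ}
    (h : w⁻¹ • ((1 : ℤ) • P.root i + (0 : ℤ) • P.root j) = m • P.root i + n • P.root j)
    (hm : 0 ≤ m) (hn : 0 ≤ n) : b.IsPos (P.weylGroupToPerm w⁻¹ i) := by
  refine isPos_of_root_eq (b := b) (i := i) (j := j) ?_ hm hn
  rw [← weylGroup_apply_root, ← h, zero_smul, add_zero, one_smul]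

/-- The root is written `1·αᵢ + 0·αⱼ` so that the coordinate rules for `sᵢ` and `sⱼ` apply to it
directly. -/
theorem muSimple_torusAct_left {b : P.Base} {z : Torus X} (hz : IsRegular P z) {i j : b.support}
    (l : List b.support) (m n : ℕ)
    (h : (wordProd b l)⁻¹ • ((1 : ℤ) • P.root i + (0 : ℤ) • P.root j) =
      (m : ℤ) • P.root i + (n : ℤ) • P.root j) :
    muSimple b (torusAct (wordProd b l) z) i = (q⁻¹ : Scalar) • ybFactor q (heckeGen b i)
      (RatFunc.C (charVal z (P.root i)) ^ m * RatFunc.C (charVal z (P.root j)) ^ n) ∧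
    (RatFunc.C (charVal z (P.root i)) ^ m * RatFunc.C (charVal z (P.root j)) ^ n : Scalar) ≠ 1 :=
  muSimple_torusAct_eq hz m n (by rwa [zero_smul, add_zero, one_smul] at h)

theorem muSimple_torusAct_right {b : P.Base} {z : Torus X} (hz : IsRegular P z)
    {i j : b.support} (l : List b.support) (m n : ℕ)
    (h : (wordProd b l)⁻¹ • ((0 : ℤ) • P.root i + (1 : ℤ) • P.root j) =
      (m : ℤ) • P.root i + (n : ℤ) • P.root j) :
    muSimple b (torusAct (wordProd b l) z) j = (q⁻¹ : Scalar) • ybFactor q (heckeGen b j)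
      (RatFunc.C (charVal z (P.root i)) ^ m * RatFunc.C (charVal z (P.root j)) ^ n) ∧
    (RatFunc.C (charVal z (P.root i)) ^ m * RatFunc.C (charVal z (P.root j)) ^ n : Scalar) ≠ 1 :=
  muSimple_torusAct_eq hz m n (by rwa [zero_smul, zero_add, one_smul] at h)

/-! ### Braid relations for two simple reflections, by type -/

section RankTwo

set_option linter.unusedSimpArgs false

variable {b : P.Base} {i j : b.support}

theorem isBraidPair_two (hji : P.pairing j i = -0) (hij : P.pairing i j = -0) :
    IsBraidPair b i j 2 := by
  have hL := simpleRefl_smul_left hji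
  have hR := simpleRefl_smul_right hij
  refine ⟨eq_of_smul_eq fun x => ?_, fun n hn => ?_, fun n hn => ?_⟩
  · simp only [altWord, wordProd_cons, wordProd_nil, mul_one, mul_smul, simpleRefl_smul, map_sub,
      map_smul, root_coroot'_eq_pairing, hji, hij, pairing_same, smul_eq_mul]
    module
  -- The coordinates of the transformed root are left open and determined by the closing `rfl`.
  · interval_cases n <;>
      refine isPos_perm_right (i := i) (h := by
        simp only [altWord, wordProd_cons, wordProd_nil, mul_inv_rev, inv_one, mul_one,
          simpleRefl_inv, mul_smul, one_smul P.weylGroup, hL, hR]; rfl) ?_ ?_ <;>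
      norm_num
  · interval_cases n <;>
      refine isPos_perm_left (j := j) (h := by
        simp only [altWord, wordProd_cons, wordProd_nil, mul_inv_rev, inv_one, mul_one,
          simpleRefl_inv, mul_smul, one_smul P.weylGroup, hL, hR]; rfl) ?_ ?_ <;>
      norm_num

theorem muWord_altWord_two (hji : P.pairing j i = -0) (hij : P.pairing i j = -0)
    {z : Torus X} (hz : IsRegular P z) :
    muWord b z (altWord i j 2) = muWord b z (altWord j i 2) := by
  have hL := simpleRefl_smul_left hji
  have hR := simpleRefl_smul_right hij
  have hbr := (isBraidPair_two hji hij).heckeGen_prod_eq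
  simp only [altWord, List.map_cons, List.map_nil, List.prod_cons, List.prod_nil, mul_one] at hbr
  obtain ⟨f1, n1⟩ := muSimple_torusAct_right hz (i := i) (j := j) [] 0 1 (by
    simp only [wordProd_cons, wordProd_nil, mul_inv_rev, inv_one, mul_one, simpleRefl_inv,
      mul_smul, one_smul P.weylGroup, hL, hR]; norm_num)
  obtain ⟨f2, n2⟩ := muSimple_torusAct_left hz (i := i) (j := j) [j] 1 0 (by
    simp only [wordProd_cons, wordProd_nil, mul_inv_rev, inv_one, mul_one, simpleRefl_inv,
      mul_smul, one_smul P.weylGroup, hL, hR]; norm_num)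
  obtain ⟨f3, n3⟩ := muSimple_torusAct_left hz (i := i) (j := j) [] 1 0 (by
    simp only [wordProd_cons, wordProd_nil, mul_inv_rev, inv_one, mul_one, simpleRefl_inv,
      mul_smul, one_smul P.weylGroup, hL, hR]; norm_num)
  obtain ⟨f4, n4⟩ := muSimple_torusAct_right hz (i := i) (j := j) [i] 0 1 (by
    simp only [wordProd_cons, wordProd_nil, mul_inv_rev, inv_one, mul_one, simpleRefl_inv,
      mul_smul, one_smul P.weylGroup, hL, hR]; norm_num)
  simp only [pow_zero, pow_one, mul_one, one_mul] at *
  simp only [altWord, muWord_cons, muWord_nil, one_mul, f1, f2, f3, f4, smul_mul_assoc,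
    mul_smul_comm, smul_smul, mul_assoc]
  rw [yangBaxter_two hbr]

theorem isBraidPair_three (hji : P.pairing j i = -1) (hij : P.pairing i j = -1) :
    IsBraidPair b i j 3 := by
  have hL := simpleRefl_smul_left hji
  have hR := simpleRefl_smul_right hij
  refine ⟨eq_of_smul_eq fun x => ?_, fun n hn => ?_, fun n hn => ?_⟩
  · simp only [altWord, wordProd_cons, wordProd_nil, mul_one, mul_smul, simpleRefl_smul, map_sub,
      map_smul, root_coroot'_eq_pairing, hji, hij, pairing_same, smul_eq_mul]
    module
  · interval_cases n <;>
      refine isPos_perm_right (i := i) (h := by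
        simp only [altWord, wordProd_cons, wordProd_nil, mul_inv_rev, inv_one, mul_one,
          simpleRefl_inv, mul_smul, one_smul P.weylGroup, hL, hR]; rfl) ?_ ?_ <;>
      norm_num
  · interval_cases n <;>
      refine isPos_perm_left (j := j) (h := by
        simp only [altWord, wordProd_cons, wordProd_nil, mul_inv_rev, inv_one, mul_one,
          simpleRefl_inv, mul_smul, one_smul P.weylGroup, hL, hR]; rfl) ?_ ?_ <;>
      norm_num

/-- The parameters of the successive factors are the values of `z` at `w⁻¹α`, for `w` the product of
the letters already used and `α` the root of the next letter. These are the positive roots of the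
rank two system, in opposite orders for the two words. -/
theorem muWord_altWord_three (hji : P.pairing j i = -1) (hij : P.pairing i j = -1)
    {z : Torus X} (hz : IsRegular P z) :
    muWord b z (altWord i j 3) = muWord b z (altWord j i 3) := by
  have hL := simpleRefl_smul_left hji
  have hR := simpleRefl_smul_right hij
  have hbr := (isBraidPair_three hji hij).heckeGen_prod_eq
  simp only [altWord, List.map_cons, List.map_nil, List.prod_cons, List.prod_nil, mul_one] at hbr
  obtain ⟨f1, n1⟩ := muSimple_torusAct_left hz (i := i) (j := j) [] 1 0 (by
    simp only [wordProd_cons, wordProd_nil, mul_inv_rev, inv_one, mul_one, simpleRefl_inv,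
      mul_smul, one_smul P.weylGroup, hL, hR]; norm_num)
  obtain ⟨f2, n2⟩ := muSimple_torusAct_right hz (i := i) (j := j) [i] 1 1 (by
    simp only [wordProd_cons, wordProd_nil, mul_inv_rev, inv_one, mul_one, simpleRefl_inv,
      mul_smul, one_smul P.weylGroup, hL, hR]; norm_num)
  obtain ⟨f3, n3⟩ := muSimple_torusAct_left hz (i := i) (j := j) [j, i] 0 1 (by
    simp only [wordProd_cons, wordProd_nil, mul_inv_rev, inv_one, mul_one, simpleRefl_inv,
      mul_smul, one_smul P.weylGroup, hL, hR]; norm_num)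
  obtain ⟨f4, n4⟩ := muSimple_torusAct_right hz (i := i) (j := j) [] 0 1 (by
    simp only [wordProd_cons, wordProd_nil, mul_inv_rev, inv_one, mul_one, simpleRefl_inv,
      mul_smul, one_smul P.weylGroup, hL, hR]; norm_num)
  obtain ⟨f5, n5⟩ := muSimple_torusAct_left hz (i := i) (j := j) [j] 1 1 (by
    simp only [wordProd_cons, wordProd_nil, mul_inv_rev, inv_one, mul_one, simpleRefl_inv,
      mul_smul, one_smul P.weylGroup, hL, hR]; norm_num)
  obtain ⟨f6, n6⟩ := muSimple_torusAct_right hz (i := i) (j := j) [i, j] 1 0 (by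
    simp only [wordProd_cons, wordProd_nil, mul_inv_rev, inv_one, mul_one, simpleRefl_inv,
      mul_smul, one_smul P.weylGroup, hL, hR]; norm_num)
  simp only [pow_zero, pow_one, mul_one, one_mul] at *
  simp only [altWord, muWord_cons, muWord_nil, one_mul, f1, f2, f3, f4, f5, f6, smul_mul_assoc,
    mul_smul_comm, smul_smul, mul_assoc]
  rw [yangBaxter_three (heckeGen_mul_self b i) (heckeGen_mul_self b j) hbr n6 n4 n5]

theorem isBraidPair_four (hji : P.pairing j i = -2) (hij : P.pairing i j = -1) :
    IsBraidPair b i j 4 := by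
  have hL := simpleRefl_smul_left hji
  have hR := simpleRefl_smul_right hij
  refine ⟨eq_of_smul_eq fun x => ?_, fun n hn => ?_, fun n hn => ?_⟩
  · simp only [altWord, wordProd_cons, wordProd_nil, mul_one, mul_smul, simpleRefl_smul, map_sub,
      map_smul, root_coroot'_eq_pairing, hji, hij, pairing_same, smul_eq_mul]
    module
  · interval_cases n <;>
      refine isPos_perm_right (i := i) (h := by
        simp only [altWord, wordProd_cons, wordProd_nil, mul_inv_rev, inv_one, mul_one,
          simpleRefl_inv, mul_smul, one_smul P.weylGroup, hL, hR]; rfl) ?_ ?_ <;>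
      norm_num
  · interval_cases n <;>
      refine isPos_perm_left (j := j) (h := by
        simp only [altWord, wordProd_cons, wordProd_nil, mul_inv_rev, inv_one, mul_one,
          simpleRefl_inv, mul_smul, one_smul P.weylGroup, hL, hR]; rfl) ?_ ?_ <;>
      norm_num

theorem muWord_altWord_four (hji : P.pairing j i = -2) (hij : P.pairing i j = -1)
    {z : Torus X} (hz : IsRegular P z) :
    muWord b z (altWord i j 4) = muWord b z (altWord j i 4) := by
  have hL := simpleRefl_smul_left hji
  have hR := simpleRefl_smul_right hij
  have hbr := (isBraidPair_four hji hij).heckeGen_prod_eq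
  simp only [altWord, List.map_cons, List.map_nil, List.prod_cons, List.prod_nil, mul_one] at hbr
  obtain ⟨f1, n1⟩ := muSimple_torusAct_right hz (i := i) (j := j) [] 0 1 (by
    simp only [wordProd_cons, wordProd_nil, mul_inv_rev, inv_one, mul_one, simpleRefl_inv,
      mul_smul, one_smul P.weylGroup, hL, hR]; norm_num)
  obtain ⟨f2, n2⟩ := muSimple_torusAct_left hz (i := i) (j := j) [j] 1 1 (by
    simp only [wordProd_cons, wordProd_nil, mul_inv_rev, inv_one, mul_one, simpleRefl_inv,
      mul_smul, one_smul P.weylGroup, hL, hR]; norm_num)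
  obtain ⟨f3, n3⟩ := muSimple_torusAct_right hz (i := i) (j := j) [i, j] 2 1 (by
    simp only [wordProd_cons, wordProd_nil, mul_inv_rev, inv_one, mul_one, simpleRefl_inv,
      mul_smul, one_smul P.weylGroup, hL, hR]; norm_num)
  obtain ⟨f4, n4⟩ := muSimple_torusAct_left hz (i := i) (j := j) [j, i, j] 1 0 (by
    simp only [wordProd_cons, wordProd_nil, mul_inv_rev, inv_one, mul_one, simpleRefl_inv,
      mul_smul, one_smul P.weylGroup, hL, hR]; norm_num)
  obtain ⟨f5, n5⟩ := muSimple_torusAct_left hz (i := i) (j := j) [] 1 0 (by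
    simp only [wordProd_cons, wordProd_nil, mul_inv_rev, inv_one, mul_one, simpleRefl_inv,
      mul_smul, one_smul P.weylGroup, hL, hR]; norm_num)
  obtain ⟨f6, n6⟩ := muSimple_torusAct_right hz (i := i) (j := j) [i] 2 1 (by
    simp only [wordProd_cons, wordProd_nil, mul_inv_rev, inv_one, mul_one, simpleRefl_inv,
      mul_smul, one_smul P.weylGroup, hL, hR]; norm_num)
  obtain ⟨f7, n7⟩ := muSimple_torusAct_left hz (i := i) (j := j) [j, i] 1 1 (by
    simp only [wordProd_cons, wordProd_nil, mul_inv_rev, inv_one, mul_one, simpleRefl_inv,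
      mul_smul, one_smul P.weylGroup, hL, hR]; norm_num)
  obtain ⟨f8, n8⟩ := muSimple_torusAct_right hz (i := i) (j := j) [i, j, i] 0 1 (by
    simp only [wordProd_cons, wordProd_nil, mul_inv_rev, inv_one, mul_one, simpleRefl_inv,
      mul_smul, one_smul P.weylGroup, hL, hR]; norm_num)
  simp only [pow_zero, pow_one, mul_one, one_mul] at *
  simp only [altWord, muWord_cons, muWord_nil, one_mul, f1, f2, f3, f4, f5, f6, f7, f8,
    smul_mul_assoc,
    mul_smul_comm, smul_smul, mul_assoc]
  rw [yangBaxter_four (heckeGen_mul_self b i) (heckeGen_mul_self b j) hbr n5 n8 n7 n6]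

theorem isBraidPair_six (hji : P.pairing j i = -3) (hij : P.pairing i j = -1) :
    IsBraidPair b i j 6 := by
  have hL := simpleRefl_smul_left hji
  have hR := simpleRefl_smul_right hij
  refine ⟨eq_of_smul_eq fun x => ?_, fun n hn => ?_, fun n hn => ?_⟩
  · simp only [altWord, wordProd_cons, wordProd_nil, mul_one, mul_smul, simpleRefl_smul, map_sub,
      map_smul, root_coroot'_eq_pairing, hji, hij, pairing_same, smul_eq_mul]
    module
  · interval_cases n <;>
      refine isPos_perm_right (i := i) (h := by
        simp only [altWord, wordProd_cons, wordProd_nil, mul_inv_rev, inv_one, mul_one,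
          simpleRefl_inv, mul_smul, one_smul P.weylGroup, hL, hR]; rfl) ?_ ?_ <;>
      norm_num
  · interval_cases n <;>
      refine isPos_perm_left (j := j) (h := by
        simp only [altWord, wordProd_cons, wordProd_nil, mul_inv_rev, inv_one, mul_one,
          simpleRefl_inv, mul_smul, one_smul P.weylGroup, hL, hR]; rfl) ?_ ?_ <;>
      norm_num

theorem muWord_altWord_six (hji : P.pairing j i = -3) (hij : P.pairing i j = -1)
    {z : Torus X} (hz : IsRegular P z) :
    muWord b z (altWord i j 6) = muWord b z (altWord j i 6) := by
  have hL := simpleRefl_smul_left hji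
  have hR := simpleRefl_smul_right hij
  have hbr := (isBraidPair_six hji hij).heckeGen_prod_eq
  simp only [altWord, List.map_cons, List.map_nil, List.prod_cons, List.prod_nil, mul_one] at hbr
  obtain ⟨f1, n1⟩ := muSimple_torusAct_right hz (i := i) (j := j) [] 0 1 (by
    simp only [wordProd_cons, wordProd_nil, mul_inv_rev, inv_one, mul_one, simpleRefl_inv,
      mul_smul, one_smul P.weylGroup, hL, hR]; norm_num)
  obtain ⟨f2, n2⟩ := muSimple_torusAct_left hz (i := i) (j := j) [j] 1 1 (by
    simp only [wordProd_cons, wordProd_nil, mul_inv_rev, inv_one, mul_one, simpleRefl_inv,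
      mul_smul, one_smul P.weylGroup, hL, hR]; norm_num)
  obtain ⟨f3, n3⟩ := muSimple_torusAct_right hz (i := i) (j := j) [i, j] 3 2 (by
    simp only [wordProd_cons, wordProd_nil, mul_inv_rev, inv_one, mul_one, simpleRefl_inv,
      mul_smul, one_smul P.weylGroup, hL, hR]; norm_num)
  obtain ⟨f4, n4⟩ := muSimple_torusAct_left hz (i := i) (j := j) [j, i, j] 2 1 (by
    simp only [wordProd_cons, wordProd_nil, mul_inv_rev, inv_one, mul_one, simpleRefl_inv,
      mul_smul, one_smul P.weylGroup, hL, hR]; norm_num)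
  obtain ⟨f5, n5⟩ := muSimple_torusAct_right hz (i := i) (j := j) [i, j, i, j] 3 1 (by
    simp only [wordProd_cons, wordProd_nil, mul_inv_rev, inv_one, mul_one, simpleRefl_inv,
      mul_smul, one_smul P.weylGroup, hL, hR]; norm_num)
  obtain ⟨f6, n6⟩ := muSimple_torusAct_left hz (i := i) (j := j) [j, i, j, i, j] 1 0 (by
    simp only [wordProd_cons, wordProd_nil, mul_inv_rev, inv_one, mul_one, simpleRefl_inv,
      mul_smul, one_smul P.weylGroup, hL, hR]; norm_num)
  obtain ⟨f7, n7⟩ := muSimple_torusAct_left hz (i := i) (j := j) [] 1 0 (by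
    simp only [wordProd_cons, wordProd_nil, mul_inv_rev, inv_one, mul_one, simpleRefl_inv,
      mul_smul, one_smul P.weylGroup, hL, hR]; norm_num)
  obtain ⟨f8, n8⟩ := muSimple_torusAct_right hz (i := i) (j := j) [i] 3 1 (by
    simp only [wordProd_cons, wordProd_nil, mul_inv_rev, inv_one, mul_one, simpleRefl_inv,
      mul_smul, one_smul P.weylGroup, hL, hR]; norm_num)
  obtain ⟨f9, n9⟩ := muSimple_torusAct_left hz (i := i) (j := j) [j, i] 2 1 (by
    simp only [wordProd_cons, wordProd_nil, mul_inv_rev, inv_one, mul_one, simpleRefl_inv,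
      mul_smul, one_smul P.weylGroup, hL, hR]; norm_num)
  obtain ⟨f10, n10⟩ := muSimple_torusAct_right hz (i := i) (j := j) [i, j, i] 3 2 (by
    simp only [wordProd_cons, wordProd_nil, mul_inv_rev, inv_one, mul_one, simpleRefl_inv,
      mul_smul, one_smul P.weylGroup, hL, hR]; norm_num)
  obtain ⟨f11, n11⟩ := muSimple_torusAct_left hz (i := i) (j := j) [j, i, j, i] 1 1 (by
    simp only [wordProd_cons, wordProd_nil, mul_inv_rev, inv_one, mul_one, simpleRefl_inv,
      mul_smul, one_smul P.weylGroup, hL, hR]; norm_num)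
  obtain ⟨f12, n12⟩ := muSimple_torusAct_right hz (i := i) (j := j) [i, j, i, j, i] 0 1 (by
    simp only [wordProd_cons, wordProd_nil, mul_inv_rev, inv_one, mul_one, simpleRefl_inv,
      mul_smul, one_smul P.weylGroup, hL, hR]; norm_num)
  simp only [pow_zero, pow_one, mul_one, one_mul] at *
  simp only [altWord, muWord_cons, muWord_nil, one_mul, f1, f2, f3, f4, f5, f6, f7, f8, f9, f10,
    f11, f12, smul_mul_assoc,
    mul_smul_comm, smul_smul, mul_assoc]
  rw [yangBaxter_six (heckeGen_mul_self b i) (heckeGen_mul_self b j) hbr n7 n12 n11 n9 n8 n10]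

end RankTwo

/-- Two distinct simple roots have nonpositive pairings, so the classification of crystallographic
reduced pairs leaves the Cartan integers of A₁ × A₁, A₂, B₂ and G₂, with `m = 2, 3, 4, 6`. -/
theorem exists_isBraidPair {b : P.Base} {i j : b.support} (hij : i ≠ j) :
    ∃ m, 0 < m ∧ IsBraidPair b i j m ∧ ∀ z : Torus X, IsRegular P z →
      muWord b z (altWord i j m) = muWord b z (altWord j i m) := by
  have hne : (i : ι) ≠ j := fun h => hij (Subtype.ext h)
  have hp := P.pairingIn_pairingIn_mem_set_of_isCrystal_of_isRed' i j
    (fun h => hne (P.root.injective h)) (b.root_ne_neg_of_ne i.2 j.2 hne)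
  have h1 := b.pairingIn_le_zero_of_ne hne i.2 j.2
  have e1 : P.pairingIn ℤ i j = P.pairing i j := P.algebraMap_pairingIn ℤ i j
  have e2 : P.pairingIn ℤ j i = P.pairing j i := P.algebraMap_pairingIn ℤ j i
  rw [e1] at hp h1
  rw [e2] at hp
  simp only [Set.mem_insert_iff, Set.mem_singleton_iff, Prod.mk.injEq] at hp
  have key : (P.pairing i j = -0 ∧ P.pairing j i = -0) ∨
      (P.pairing i j = -1 ∧ P.pairing j i = -1) ∨ (P.pairing i j = -1 ∧ P.pairing j i = -2) ∨
      (P.pairing i j = -2 ∧ P.pairing j i = -1) ∨ (P.pairing i j = -1 ∧ P.pairing j i = -3) ∨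
      (P.pairing i j = -3 ∧ P.pairing j i = -1) := by omega
  rcases key with ⟨h, h'⟩ | ⟨h, h'⟩ | ⟨h, h'⟩ | ⟨h, h'⟩ | ⟨h, h'⟩ | ⟨h, h'⟩
  · exact ⟨2, by norm_num, isBraidPair_two h' h, fun z hz => muWord_altWord_two h' h hz⟩
  · exact ⟨3, by norm_num, isBraidPair_three h' h, fun z hz => muWord_altWord_three h' h hz⟩
  · exact ⟨4, by norm_num, isBraidPair_four h' h, fun z hz => muWord_altWord_four h' h hz⟩
  · exact ⟨4, by norm_num, (isBraidPair_four h h').symm,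
      fun z hz => (muWord_altWord_four h h' hz).symm⟩
  · exact ⟨6, by norm_num, isBraidPair_six h' h, fun z hz => muWord_altWord_six h' h hz⟩
  · exact ⟨6, by norm_num, (isBraidPair_six h h').symm,
      fun z hz => (muWord_altWord_six h h' hz).symm⟩

/-! ### Independence of the reduced word -/

/-- The exchange condition deletes a letter of `l ++ t`. It cannot lie in `l`, which `sⱼ` lengthens,
so it lies in `t` and `j` may be put in front instead. -/
theorem exists_isReducedWord_cons_append {b : P.Base} {j : b.support} {l t : List b.support}
    (h : IsReducedWord b (l ++ t))
    (hl : length b (wordProd b l) < length b (simpleRefl b j * wordProd b l))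
    (hw : length b (simpleRefl b j * wordProd b (l ++ t)) < length b (wordProd b (l ++ t))) :
    ∃ t', IsReducedWord b (j :: l ++ t') ∧ wordProd b (j :: l ++ t') = wordProd b (l ++ t) := by
  obtain ⟨k, hk, e⟩ := simpleRefl_mul_wordProd b (l ++ t) j hw
  rcases lt_or_ge k l.length with hkl | hkl
  · exfalso
    rw [List.eraseIdx_append_of_lt_length hkl, wordProd_append, wordProd_append, ← mul_assoc,
      mul_right_cancel_iff] at e
    have h1 := length_wordProd_le b (l.eraseIdx k)
    rw [List.length_eraseIdx_of_lt hkl, ← e] at h1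
    have h2 := h.of_append_left
    rw [IsReducedWord] at h2
    omega
  · rw [List.eraseIdx_append_of_length_le hkl] at e
    have e' : wordProd b (j :: l ++ t.eraseIdx (k - l.length)) = wordProd b (l ++ t) := by
      rw [List.cons_append, wordProd_cons, ← e, simpleRefl_mul_cancel]
    refine ⟨_, ?_, e'⟩
    rw [List.length_append] at hk
    rw [IsReducedWord] at h ⊢
    rw [e', h, List.length_append, List.length_append, List.length_cons,
      List.length_eraseIdx_of_lt (by omega)]
    omega

theorem IsReducedWord.of_wordProd_eq {b : P.Base} {l l' : List b.support} (h : IsReducedWord b l)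
    (e : wordProd b l' = wordProd b l) (hl : l'.length = l.length) : IsReducedWord b l' := by
  rw [IsReducedWord, e, h, hl]

/-- `μ_z(w)` does not depend on the reduced word of `w`. -/
theorem muWord_eq_of_isReducedWord {b : P.Base} {l l' : List b.support} (hl : IsReducedWord b l)
    (hl' : IsReducedWord b l') (h : wordProd b l = wordProd b l') {z : Torus X}
    (hz : IsRegular P z) : muWord b z l = muWord b z l' := by
  induction hn : l.length generalizing l l' with
  | zero =>
    rw [List.length_eq_zero_iff] at hn
    subst hn
    have : l'.length = 0 := by
      rw [IsReducedWord, ← h] at hl'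
      rw [← hl']; simp
    rw [List.length_eq_zero_iff] at this
    rw [this]
  | succ n ih =>
    have hlen : l.length = l'.length := by
      rw [IsReducedWord] at hl hl'; rw [← hl, ← hl', h]
    have same : ∀ (s : b.support) (t t' : List b.support), IsReducedWord b (s :: t) →
        IsReducedWord b (s :: t') → wordProd b (s :: t) = wordProd b (s :: t') →
        (s :: t).length = n + 1 → muWord b z (s :: t) = muWord b z (s :: t') := by
      intro s t t' ht ht' e hlen
      have e' : wordProd b t = wordProd b t' := by
        rwa [wordProd_cons, wordProd_cons, mul_right_inj] at e
      rw [muWord_cons, muWord_cons, e',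
        ih ht.of_cons ht'.of_cons e' (by simpa using hlen)]
    obtain ⟨i, t, rfl⟩ : ∃ i t, l = i :: t := List.exists_cons_of_length_eq_add_one hn
    obtain ⟨j, t', rfl⟩ : ∃ j t', l' = j :: t' :=
      List.exists_cons_of_length_eq_add_one (hlen.symm.trans hn)
    by_cases hij : i = j
    · subst hij
      exact same i t t' hl hl' h hn
    · obtain ⟨m, hm, hbr, hmu⟩ := exists_isBraidPair hij
      set w := wordProd b (i :: t) with hw
      have hwi : length b (simpleRefl b i * w) < length b w := by
        have := hl.length_lt
        rw [hw, wordProd_cons]; simpa using this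
      have hwj : length b (simpleRefl b j * w) < length b w := by
        have := hl'.length_lt
        rw [h, wordProd_cons]; simpa using this
      -- Both `sᵢ` and `sⱼ` shorten `w`, so an alternating prefix of a reduced word of `w` can be
      -- grown letter by letter to length `m`, ending with either first letter.
      have key : ∀ k ≤ m,
          (∃ r, IsReducedWord b (altWord i j k ++ r) ∧ wordProd b (altWord i j k ++ r) = w) ∧
          (∃ r, IsReducedWord b (altWord j i k ++ r) ∧ wordProd b (altWord j i k ++ r) = w) := by
        intro k
        induction k with
        | zero => exact fun _ => ⟨⟨i :: t, hl, rfl⟩, ⟨i :: t, hl, rfl⟩⟩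
        | succ k ihk =>
          intro hk
          obtain ⟨⟨r, hr, er⟩, ⟨r', hr', er'⟩⟩ := ihk (by omega)
          constructor
          · have := exists_isReducedWord_cons_append hr'
              ((length_lt_simpleRefl_mul_iff b _ i).mpr (hbr.pos_right k (by omega)))
              (by rw [er']; exact hwi)
            rwa [er'] at this
          · have := exists_isReducedWord_cons_append hr
              ((length_lt_simpleRefl_mul_iff b _ j).mpr (hbr.pos_left k (by omega)))
              (by rw [er]; exact hwj)
            rwa [er] at this
      -- The given words are linked through two words that differ by one braid move; the outer links
      -- share a first letter and fall under the induction.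
      obtain ⟨⟨r, hr, er⟩, -⟩ := key m le_rfl
      have e2 : wordProd b (altWord j i m ++ r) = wordProd b (altWord i j m ++ r) := by
        rw [wordProd_append, wordProd_append, hbr.prod_eq]
      have hr2 : IsReducedWord b (altWord j i m ++ r) := hr.of_wordProd_eq e2 (by simp)
      have hmid : muWord b z (altWord i j m ++ r) = muWord b z (altWord j i m ++ r) := by
        rw [muWord_append, muWord_append, hmu _ (hz.torusAct _)]
      obtain ⟨p, rfl⟩ : ∃ p, m = p + 1 := ⟨m - 1, by omega⟩
      exact (same i t _ hl hr er.symm hn).trans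
        (hmid.trans (same j t' _ hl' hr2 (h.symm.trans (er.symm.trans e2.symm))
          (hlen.symm.trans hn)).symm)

/-- The product of factors `μ` along an arbitrary word is a multiple of the product along any
reduced word with the same value. -/
theorem exists_muWord_eq_smul (b : P.Base) (l : List b.support) {z : Torus X}
    (hz : IsRegular P z) : ∃ κ : Scalar, ∃ l', IsReducedWord b l' ∧ wordProd b l' = wordProd b l ∧
      muWord b z l = κ • muWord b z l' := by
  induction l with
  | nil => exact ⟨1, [], by simp [IsReducedWord], rfl, by simp⟩
  | cons i l ih =>
    obtain ⟨κ, l', hl', e, hκ⟩ := ih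
    rcases lt_or_gt_of_ne (length_simpleRefl_mul_ne b i (wordProd b l')) with hi | hi
    -- When the new letter shortens the element, the reduced word can be chosen to begin with `i`,
    -- and the two factors for `i` collapse to a scalar.
    · obtain ⟨t, ht, hlt⟩ := exists_reducedWord b (simpleRefl b i * wordProd b l')
      have hti : wordProd b (i :: t) = wordProd b l' := by
        rw [wordProd_cons, ht, simpleRefl_mul_cancel]
      have htr : IsReducedWord b t := by rw [IsReducedWord, ht, hlt]
      have hir : IsReducedWord b (i :: t) := htr.cons (by rw [ht]; simpa using hi)
      obtain ⟨c, hc⟩ := exists_muSimple_mul_muSimple b (hz.torusAct (wordProd b t)) i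
      refine ⟨κ * c, t, htr, by rw [ht, e, wordProd_cons], ?_⟩
      rw [muWord_cons, hκ, muWord_eq_of_isReducedWord hl' hir hti.symm hz, muWord_cons, ← e, ← hti,
        wordProd_cons, torusAct_mul, smul_mul_assoc, mul_assoc, hc, mul_smul_comm, mul_one, smul_smul]
    · exact ⟨κ, i :: l', hl'.cons hi, by rw [wordProd_cons, e, wordProd_cons], by
        rw [muWord_cons, hκ, muWord_cons, e, smul_mul_assoc]⟩

/-! ### Orthogonality -/

theorem IsReducedWord.reverse {b : P.Base} {l : List b.support} (h : IsReducedWord b l) :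
    IsReducedWord b l.reverse := by
  rw [IsReducedWord] at h ⊢
  rw [wordProd_reverse, length_inv, h, List.length_reverse]

theorem qpow_one (b : P.Base) : qpow b (1 : P.weylGroup) = 1 := by simp [qpow]

theorem heckeForm_muWord_longElement (b : P.Base) (z : Torus X) (l : List b.support) :
    heckeForm b (Finsupp.single 1 1) ((muWord b z l : Module.End Scalar (HeckeModule P))
      (Finsupp.single (longElement b) 1)) = qpow b (longElement b) *
        muVec b (torusAct (wordProd b l) z⁻¹) l.reverse (longElement b) := by
  rw [heckeForm_comm, heckeForm_muWord, heckeForm_single_left]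
  rfl

theorem heckeForm_muWord_longElement_eq_one {b : P.Base} (z : Torus X) {l : List b.support}
    (hl : IsReducedWord b l) (h : wordProd b l = longElement b) :
    heckeForm b (Finsupp.single 1 1) ((muWord b z l : Module.End Scalar (HeckeModule P))
      (Finsupp.single (longElement b) 1)) = 1 := by
  have := muVec_wordProd_inv b (torusAct (wordProd b l) z⁻¹) hl.reverse
  rw [wordProd_reverse, inv_inv, List.length_reverse, ← hl] at this
  rw [heckeForm_muWord_longElement, ← h, this, qpow, ← mul_pow, mul_inv_cancel₀ q_ne_zero, one_pow]

/-- After reduction to a reduced word, adjointness turns the pairing into a coefficient of `T_{w₀}`.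
The support lies below an element other than `w₀`, hence does not contain `w₀`. -/
theorem heckeForm_muWord_longElement_eq_zero {b : P.Base} {z : Torus X} (hz : IsRegular P z)
    (l : List b.support) (h : wordProd b l ≠ longElement b) :
    heckeForm b (Finsupp.single 1 1) ((muWord b z l : Module.End Scalar (HeckeModule P))
      (Finsupp.single (longElement b) 1)) = 0 := by
  obtain ⟨κ, l', hl', e, hκ⟩ := exists_muWord_eq_smul b l hz
  rw [← e] at h
  rw [hκ, Subalgebra.coe_smul, LinearMap.smul_apply, map_smul, heckeForm_muWord_longElement]
  have : muVec b (torusAct (wordProd b l') z⁻¹) l'.reverse (longElement b) = 0 := by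
    by_contra hne
    rw [← longElement_inv] at hne
    have hle := bruhatLE_of_muVec_ne_zero b _ hl'.reverse _ hne
    rw [wordProd_reverse] at hle
    apply h
    rcases eq_or_length_lt_of_bruhatLE hle with h' | h'
    · rw [← longElement_inv, h', inv_inv]
    · have := length_le_longElement b (wordProd b l')
      rw [length_inv] at h'
      omega
  rw [this, mul_zero, smul_zero]

/-- `q_u` times the coefficient of `T_{u⁻¹}` in `μ_z(v)`. -/
noncomputable def rBar (b : P.Base) (z : Torus X) (u v : P.weylGroup) : Scalar :=
  qpow b u * muVec b z (reducedWord b v) u⁻¹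

theorem r_eq_bar_rBar (b : P.Base) (z : Torus X) (u v : P.weylGroup) :
    r b z u v = bar (rBar b z u v) := rfl

theorem bruhatLE_of_rBar_ne_zero {b : P.Base} {z : Torus X} {u v : P.weylGroup}
    (h : rBar b z u v ≠ 0) : bruhatLE b u v := by
  have := bruhatLE_of_muVec_ne_zero b z (isReducedWord_reducedWord b v) u (right_ne_zero_of_mul h)
  rwa [wordProd_reducedWord] at this

/-- The orthogonality relation behind the theorem: moving `μ_z(y)` across the form joins the two
products into one along a word for `w₀xy⁻¹`. -/
theorem heckeForm_muVec_longTwist (b : P.Base) {z : Torus X} (hz : IsRegular P z)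
    (x y : P.weylGroup) :
    heckeForm b (muVec b z (reducedWord b y))
      (longTwist b (muVec b z (reducedWord b (longElement b * x)))) =
      if x = y then eps b x * (qpow b (longElement b))⁻¹ else 0 := by
  -- The reversed word starts at `(yz)⁻¹` and returns to `z⁻¹`, the point to which the twist moves
  -- `μ_z(w₀x)`. So the two products fit together.
  have ht : torusAct (wordProd b (reducedWord b y).reverse)
      (torusAct (wordProd b (reducedWord b y)) z⁻¹) = z⁻¹ := by
    rw [← torusAct_mul, wordProd_reverse, inv_mul_cancel, torusAct_one]
  have happ := muWord_append b (torusAct (wordProd b (reducedWord b y)) z⁻¹)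
    (reducedWord b (longElement b * x)) (reducedWord b y).reverse
  rw [ht] at happ
  rw [muVec, muVec, longTwist_muWord b hz, heckeForm_muWord, longTwist_single, one_mul, map_smul,
    map_smul, map_smul, map_smul, ← Module.End.mul_apply, ← MulMemClass.coe_mul, ← happ,
    map_smul]
  have hprod : wordProd b (reducedWord b (longElement b * x) ++ (reducedWord b y).reverse) =
      longElement b * (x * y⁻¹) := by
    rw [wordProd_append, wordProd_reverse, wordProd_reducedWord, wordProd_reducedWord, mul_assoc]
  by_cases hxy : x = y
  · subst hxy
    rw [mul_inv_cancel, mul_one] at hprod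
    -- The concatenation has length `l(w₀x) + l(x) = l(w₀)`.
    have hred : IsReducedWord b (reducedWord b (longElement b * x) ++ (reducedWord b x).reverse) := by
      rw [IsReducedWord, hprod, List.length_append, List.length_reverse, length_reducedWord,
        length_reducedWord, length_longElement_mul_add]
    rw [if_pos rfl, heckeForm_muWord_longElement_eq_one _ hred hprod, length_reducedWord]
    change eps b (longElement b * x) • _ = _
    have := eps_mul_self b (longElement b)
    rw [eps_mul, smul_eq_mul, smul_eq_mul]
    linear_combination (eps b x * (qpow b (longElement b))⁻¹) * this
  · rw [if_neg hxy, heckeForm_muWord_longElement_eq_zero (hz.inv.torusAct _), smul_zero, smul_zero]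
    rw [hprod]
    intro h
    apply hxy
    rwa [mul_eq_left, mul_inv_eq_one] at h

/-- The pairing written in coordinates `w = v⁻¹`. The normalizing factors `q_{w₀v} q_v` all equal
`q_{w₀}` and leave the sum. -/
theorem sum_rBar_mul_rBar (b : P.Base) {z : Torus X} (hz : IsRegular P z) (x y : P.weylGroup) :
    ∑ v, eps b x * eps b v * rBar b z (longElement b * v) (longElement b * x) * rBar b z v y =
      if x = y then 1 else 0 := by
  have h := heckeForm_muVec_longTwist b hz x y
  rw [heckeForm_longTwist, ← Equiv.sum_comp (Equiv.inv P.weylGroup)] at h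
  simp only [Equiv.inv_apply, eps_inv] at h
  have hq : ∀ v, qpow b (longElement b * v) * qpow b v = qpow b (longElement b) := fun v => by
    rw [qpow, qpow, ← pow_add, length_longElement_mul_add]; rfl
  calc _ = eps b x * qpow b (longElement b) * ∑ v, eps b v * muVec b z (reducedWord b y) v⁻¹ *
        muVec b z (reducedWord b (longElement b * x)) (v⁻¹ * longElement b) := by
        rw [Finset.mul_sum]
        refine Finset.sum_congr rfl fun v _ => ?_
        rw [rBar, rBar, mul_inv_rev, longElement_inv, ← hq v]
        ring
    _ = _ := by
        rw [h]
        split_ifs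
        · have h1 := eps_mul_self b x
          have h2 := mul_inv_cancel₀ (qpow_ne_zero b (longElement b))
          linear_combination (qpow b (longElement b) * (qpow b (longElement b))⁻¹) * h1 + h2
        · rw [mul_zero]

/-! ### The matrices `m` and `r` -/

/-- The matrix `ε_u ε_v a_{w₀ v, w₀ u}` attached to a matrix `a`. -/
noncomputable def signedTwist (b : P.Base) (a : Matrix P.weylGroup P.weylGroup Scalar) :
    Matrix P.weylGroup P.weylGroup Scalar :=
  Matrix.of fun u v => eps b u * eps b v * a (longElement b * v) (longElement b * u)

theorem signedTwist_mul_rBar (b : P.Base) {z : Torus X} (hz : IsRegular P z) :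
    signedTwist b (Matrix.of (rBar b z)) * Matrix.of (rBar b z) = 1 := by
  ext x y
  rw [Matrix.mul_apply, Matrix.one_apply]
  exact sum_rBar_mul_rBar b hz x y

theorem bar_eps (b : P.Base) (w : P.weylGroup) : bar (eps b w) = eps b w := by
  simp [eps]

theorem signedTwist_mul_rMatrix (b : P.Base) {z : Torus X} (hz : IsRegular P z) :
    signedTwist b (rMatrix b z) * rMatrix b z = 1 := by
  -- The bar is a ring homomorphism fixing signs, so it may be applied entrywise to the matrix
  -- identity.
  have h := congrArg (fun a => a.map bar) (signedTwist_mul_rBar b hz)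
  simp only [Matrix.map_mul, Matrix.map_one bar (map_zero _) (map_one _)] at h
  rw [← h]
  congr 1
  ext u v
  simp [signedTwist, rMatrix, r_eq_bar_rBar, bar_eps]

/-! ### Passage to the matrix `m` by Möbius inversion -/

/-- `Λ(T_x h) = ⟨T_1, T_x h⟩ = ⟨T_{x⁻¹}, h⟩` by adjointness, and the form contributes the weight
`q_x`. -/
theorem Lam_heckeT_mul_mu (b : P.Base) (z : Torus X) (x v : P.weylGroup) :
    Lam b (heckeT b x * mu b z v) = rBar b z x v := by
  have h1 : Lam b (heckeT b x * mu b z v) = heckeForm b (Finsupp.single 1 1)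
      (((heckeT b x : Module.End Scalar (HeckeModule P))) (muVec b z (reducedWord b v))) := by
    rw [heckeForm_single_left, qpow_one, one_mul]; rfl
  rw [h1, heckeForm_comm, heckeT, heckeForm_heckeGen_prod,
    heckeGen_prod_single (isReducedWord_reducedWord b x).reverse, heckeForm_comm,
    heckeForm_single_left, wordProd_reverse, wordProd_reducedWord, rBar, qpow, qpow, length_inv]

theorem m_eq_sum (b : P.Base) (z : Torus X) (u v : P.weylGroup) :
    m b z u v = ∑ x ∈ bruhatIci b u, rBar b z x v := by
  rw [m, psi, Finset.sum_mul, map_sum]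
  exact Finset.sum_congr rfl fun x _ => Lam_heckeT_mul_mu b z x v

theorem mem_bruhatIci {b : P.Base} {u x : P.weylGroup} : x ∈ bruhatIci b u ↔ bruhatLE b u x := by
  simp [bruhatIci]

open Classical in
/-- The zeta matrix of the Bruhat order. -/
noncomputable def bruhatZeta (b : P.Base) : Matrix P.weylGroup P.weylGroup Scalar :=
  Matrix.of fun u v => if bruhatLE b u v then 1 else 0

open Classical in
/-- The Möbius matrix of the Bruhat order. -/
noncomputable def bruhatMoebius (b : P.Base) : Matrix P.weylGroup P.weylGroup Scalar :=
  Matrix.of fun u v => if bruhatLE b u v then eps b u * eps b v else 0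

theorem bruhatZeta_mul_bruhatMoebius (b : P.Base) : bruhatZeta b * bruhatMoebius b = 1 := by
  classical
  ext u v
  have h : ∀ x, bruhatZeta b u x * bruhatMoebius b x v =
      if bruhatLE b u x ∧ bruhatLE b x v then eps b x * eps b v else 0 := fun x => by
    rw [bruhatZeta, bruhatMoebius, Matrix.of_apply, Matrix.of_apply]
    by_cases h1 : bruhatLE b u x <;> simp [h1]
  rw [Matrix.mul_apply, Finset.sum_congr rfl fun x _ => h x, ← Finset.sum_filter,
    show Finset.univ.filter (fun x => bruhatLE b u x ∧ bruhatLE b x v) = bruhatIcc b u v from by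
      ext x; simp [mem_bruhatIcc], ← Finset.sum_mul, Matrix.one_apply]
  by_cases huv : u = v
  · subst huv
    have : bruhatIcc b u u = {u} := by
      ext x
      rw [mem_bruhatIcc, Finset.mem_singleton]
      refine ⟨fun h => bruhatLE_antisymm h.2 h.1, ?_⟩
      rintro rfl
      exact ⟨bruhatLE_refl _ _, bruhatLE_refl _ _⟩
    rw [this, Finset.sum_singleton, eps_mul_self, if_pos rfl]
  · rw [sum_eps_bruhatIcc b u v huv, zero_mul, if_neg huv]

theorem mMatrix_eq (b : P.Base) (z : Torus X) :
    mMatrix b z = bruhatZeta b * Matrix.of (rBar b z) := by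
  classical
  ext u v
  rw [Matrix.mul_apply, mMatrix, Matrix.of_apply, m_eq_sum, bruhatIci, Finset.sum_filter]
  refine Finset.sum_congr rfl fun x _ => ?_
  simp [bruhatZeta]

/-- The twist reverses products, and it sends the zeta matrix to the Möbius matrix because left
multiplication by `w₀` reverses the Bruhat order. -/
theorem signedTwist_mMatrix (b : P.Base) (z : Torus X) :
    signedTwist b (mMatrix b z) = signedTwist b (Matrix.of (rBar b z)) * bruhatMoebius b := by
  classical
  ext u v
  rw [Matrix.mul_apply, signedTwist, Matrix.of_apply, mMatrix, Matrix.of_apply, m_eq_sum,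
    bruhatIci, Finset.sum_filter, ← Equiv.sum_comp (Equiv.mulLeft (longElement b)),
    Finset.mul_sum]
  refine Finset.sum_congr rfl fun x _ => ?_
  simp only [Equiv.coe_mulLeft, longElement_mul_bruhatLE_iff, signedTwist, bruhatMoebius,
    Matrix.of_apply]
  split_ifs
  · have := eps_mul_self b x
    linear_combination (-(eps b u * eps b v *
      rBar b z (longElement b * x) (longElement b * u))) * this
  · simp

theorem mMatrix_mul_signedTwist (b : P.Base) {z : Torus X} (hz : IsRegular P z) :
    mMatrix b z * signedTwist b (mMatrix b z) = 1 := by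
  rw [signedTwist_mMatrix, mMatrix_eq, mul_assoc,
    ← mul_assoc (Matrix.of (rBar b z)), mul_eq_one_comm.mp (signedTwist_mul_rBar b hz), one_mul,
    bruhatZeta_mul_bruhatMoebius]

theorem bruhatLE_of_r_ne_zero {b : P.Base} {z : Torus X} {u v : P.weylGroup}
    (h : r b z u v ≠ 0) : bruhatLE b u v :=
  bruhatLE_of_rBar_ne_zero fun h' => h (by rw [r_eq_bar_rBar, h', map_zero])

theorem bruhatLE_of_m_ne_zero {b : P.Base} {z : Torus X} {u v : P.weylGroup}
    (h : m b z u v ≠ 0) : bruhatLE b u v := by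
  rw [m_eq_sum] at h
  obtain ⟨x, hx, hne⟩ := Finset.exists_ne_zero_of_sum_ne_zero h
  exact bruhatLE_trans (mem_bruhatIci.mp hx) (bruhatLE_of_rBar_ne_zero hne)

/-- Triangularity of `a`, applied also to the factor at `w₀v, w₀x`, kills every term of the matrix
product outside the interval. -/
theorem sum_bruhatIcc_of_mul_signedTwist {b : P.Base} {a : P.weylGroup → P.weylGroup → Scalar}
    (ha : Matrix.of a * signedTwist b (Matrix.of a) = 1)
    (hs : ∀ u v, a u v ≠ 0 → bruhatLE b u v) (u v : P.weylGroup) :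
    ∑ x ∈ bruhatIcc b u v, a u x * eps b x * eps b v * a (longElement b * v) (longElement b * x) =
      if u = v then 1 else 0 := by
  rw [← Matrix.one_apply, ← ha, Matrix.mul_apply]
  refine (Finset.sum_subset (Finset.subset_univ _) ?_).trans
    (Finset.sum_congr rfl fun x _ => ?_)
  · intro x _ hx
    by_contra hne
    apply hx
    rw [mem_bruhatIcc]
    exact ⟨hs _ _ (fun h => hne (by rw [h]; ring)),
      longElement_mul_bruhatLE_iff.mp (hs _ _ (fun h => hne (by rw [h]; ring)))⟩
  · simp only [signedTwist, Matrix.of_apply]; ring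

end CasselmanBasis

theorem mainTheorem1 {ι X Y : Type*} [Finite ι]
    [AddCommGroup X] [AddCommGroup Y] [Module.Finite ℤ X] [Module.Finite ℤ Y]
    (P : RootDatum ι X Y) [P.IsReduced] (b : P.Base)
    (z : CasselmanBasis.Torus X) (hz : CasselmanBasis.IsRegular P z) :
    (∀ u v : P.weylGroup, CasselmanBasis.bruhatLE b u v →
      ∑ x ∈ CasselmanBasis.bruhatIcc b u v,
        CasselmanBasis.r b z u x * CasselmanBasis.eps b x * CasselmanBasis.eps b v *
          CasselmanBasis.r b z (CasselmanBasis.longElement b * v)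
            (CasselmanBasis.longElement b * x) = if u = v then 1 else 0) ∧
    (∀ u v : P.weylGroup, CasselmanBasis.bruhatLE b u v →
      ∑ x ∈ CasselmanBasis.bruhatIcc b u v,
        CasselmanBasis.m b z u x * CasselmanBasis.eps b x * CasselmanBasis.eps b v *
          CasselmanBasis.m b z (CasselmanBasis.longElement b * v)
            (CasselmanBasis.longElement b * x) = if u = v then 1 else 0) ∧
    (IsUnit (CasselmanBasis.mMatrix b z) ∧
      ∀ u v : P.weylGroup, (CasselmanBasis.mMatrix b z)⁻¹ u v =
        CasselmanBasis.eps b u * CasselmanBasis.eps b v *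
          CasselmanBasis.m b z (CasselmanBasis.longElement b * v)
            (CasselmanBasis.longElement b * u)) ∧
    (IsUnit (CasselmanBasis.rMatrix b z) ∧
      ∀ u v : P.weylGroup, (CasselmanBasis.rMatrix b z)⁻¹ u v =
        CasselmanBasis.eps b u * CasselmanBasis.eps b v *
          CasselmanBasis.r b z (CasselmanBasis.longElement b * v)
            (CasselmanBasis.longElement b * u)) := by
  -- For finite square matrices a left inverse is also a right inverse.
  have hr := mul_eq_one_comm.mp (CasselmanBasis.signedTwist_mul_rMatrix b hz)
  have hm := CasselmanBasis.mMatrix_mul_signedTwist b hz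
  refine ⟨fun u v _ => ?_, fun u v _ => ?_, ⟨?_, fun u v => ?_⟩, ⟨?_, fun u v => ?_⟩⟩
  · exact CasselmanBasis.sum_bruhatIcc_of_mul_signedTwist hr
      (fun _ _ => CasselmanBasis.bruhatLE_of_r_ne_zero) u v
  · exact CasselmanBasis.sum_bruhatIcc_of_mul_signedTwist hm
      (fun _ _ => CasselmanBasis.bruhatLE_of_m_ne_zero) u v
  · exact IsUnit.of_mul_eq_one _ hm
  · rw [Matrix.inv_eq_right_inv hm]
    rfl
  · exact IsUnit.of_mul_eq_one _ hr
  · rw [Matrix.inv_eq_right_inv hr]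
    rfl
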